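/- **Conventions.** A *locally discrete $\mathscr F$-category* is a category $\mathsf A$ (regarded as a 2-category with only identity 2-cells) with a class of morphisms, called *inert*, that contains all identities and is closed under composition; $\mathsf A_{\mathsf{inert}}$ is the wide subcategory of inert morphisms. A *cone* with vertex $a$ in $\mathsf A$ is a strict 2-functor $S:\mathcal J\to a\downarrow\mathsf A_{\mathsf{inert}}$ from a strict 2-category $\mathcal J$ (so all its projections and transition morphisms are inert). A *locally discrete $\mathscr F$-sketch* is a locally discrete $\mathscr F$-category with a collection of *marked* cones. A *pseudo-$\mathscr F$-functor* $P:\mathsf A\to\mathcal C\mathsf{at}$ is a pseudofunctor whose unitors $1_{Pa}\Rightarrow P(1_a)$ are identities and whose compositors $Pg\,Pf\Rightarrow P(gf)$ are identities whenever $f$ or $g$ is inert; it thus restricts to a strict functor on $\mathsf A_{\mathsf{inert}}$. It is a *pseudo-model* if for every marked cone $S:\mathcal J\to a\downarrow\mathsf A_{\mathsf{inert}}$ the composite $\mathcal J\to a\downarrow\mathsf A_{\mathsf{inert}}\to Pa\downarrow\mathcal C\mathsf{at}$ is a (strict, 2-categorical) limit cone in $\mathcal C\mathsf{at}$. A *pseudo-$\mathscr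 F$-transformation* is a pseudonatural transformation whose naturality 2-cells at inert morphisms are identities. $\mathcal P\mathsf{sMod}^{\mathsf p}_{\mathscr F}(\mathsf A,\mathcal C\mathsf{at})$ is the strict 2-category of pseudo-models, pseudo-$\mathscr F$-transformations and modifications. A *strict $\mathsf{Set}$-valued model* of $\mathsf A$ is a functor $M:\mathsf A\to\mathsf{Set}$ that sends every marked cone to a limit cone; composing with the inclusion of sets as discrete categories, $M$ is also a pseudo-model in $\mathcal C\mathsf{at}$. **Theorem.** Let $\mathsf A$ be a locally discrete $\mathscr F$-sketch and let $M:\mathsf A\to\mathsf{Set}$ be a strict $\mathsf{Set}$-valued model of $\mathsf A$. Let $\pi_M:\mathcal E\mathsf l(M)\to\mathsf A$ be the category of elements of $M$, with the following $\mathscr F$-sketch structure: a morphism of $\mathcal E\mathsf l(M)$ is inert if and only if its image under $\pi_M$ is inert, and a cone in $\mathcal E\mathsf l(M)$ is marked if and only if its image under $\pi_M$ is marked in $\mathsf A$. Then there is an equivalence of 2-categories $$\mathcal P\mathsf{sMod}^{\mathsf p}_{\mathscr F}(\mathsf A,\mathcal C\mathsf{at})\downarrow M\;\simeq\;\mathcal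 P\mathsf{sMod}^{\mathsf p}_{\mathscr F}(\mathcal E\mathsf l(M),\mathcal C\mathsf{at}).$$ Here the left-hand side is the strict slice 2-category over $M$ (1-cells are strictly commuting triangles over $M$, and 2-cells are those whose whiskering with the structure map to $M$ is an identity), and an equivalence of 2-categories is a strict 2-functor that is an isomorphism on hom-categories and is essentially surjective on objects up to isomorphism. -/

import Mathlib

open CategoryTheory Bicategory
open scoped CategoryTheory.Pseudofunctor.StrongTrans

universe w uJ vJ wJ w₁ w₂ v v₁ v₂ u u₁ u₂

/-! ### Generalities on strict 2-categories

A strict 2-category is a `Bicategory` satisfying `Bicategory.Strict`. -/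

/-- A locally full sub-2-category of `B`: a class of objects and a class of 1-cells containing
identities and closed under composition; all 2-cells between the chosen 1-cells are kept. -/
structure LocallyFullSub (B : Type u) [Bicategory.{w, v} B] where
  objProp : B → Prop
  homProp : ∀ {x y : B}, (x ⟶ y) → Prop
  id_mem : ∀ x : B, objProp x → homProp (𝟙 x)
  comp_mem : ∀ {x y z : B} (f : x ⟶ y) (g : y ⟶ z),
    objProp x → objProp y → objProp z → homProp f → homProp g → homProp (f ≫ g)

namespace LocallyFullSub

variable {B : Type u} [Bicategory.{w, v} B]

/-- Objects of the sub-2-category. -/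
structure Obj (S : LocallyFullSub B) where
  obj : B
  property : S.objProp obj

variable {S : LocallyFullSub B}

/-- 1-cells of the sub-2-category. -/
@[ext]
structure Hom (X Y : S.Obj) where
  hom : X.obj ⟶ Y.obj
  property : S.homProp hom

instance : CategoryStruct S.Obj where
  Hom X Y := Hom X Y
  id X := ⟨𝟙 X.obj, S.id_mem _ X.property⟩
  comp {X Y Z} f g :=
    ⟨f.hom ≫ g.hom, S.comp_mem _ _ X.property Y.property Z.property f.property g.property⟩

@[ext]
theorem hom_ext {X Y : S.Obj} {f g : X ⟶ Y} (h : f.hom = g.hom) : f = g := Hom.ext h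

@[simp] theorem id_hom (X : S.Obj) : (𝟙 X : X ⟶ X).hom = 𝟙 X.obj := rfl

@[simp] theorem comp_hom {X Y Z : S.Obj} (f : X ⟶ Y) (g : Y ⟶ Z) :
    (f ≫ g).hom = f.hom ≫ g.hom := rfl

/-- 2-cells of the sub-2-category. -/
@[ext]
structure Hom₂ {X Y : S.Obj} (f g : X ⟶ Y) where
  hom : f.hom ⟶ g.hom

instance (X Y : S.Obj) : Category (X ⟶ Y) where
  Hom f g := Hom₂ f g
  id f := ⟨𝟙 f.hom⟩
  comp η θ := ⟨η.hom ≫ θ.hom⟩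
  id_comp η := Hom₂.ext (Category.id_comp η.hom)
  comp_id η := Hom₂.ext (Category.comp_id η.hom)
  assoc η θ ι := Hom₂.ext (Category.assoc η.hom θ.hom ι.hom)

@[ext]
theorem hom₂_ext {X Y : S.Obj} {f g : X ⟶ Y} {η θ : f ⟶ g} (h : η.hom = θ.hom) : η = θ :=
  Hom₂.ext h

@[simp] theorem id_hom₂ {X Y : S.Obj} (f : X ⟶ Y) : (𝟙 f : f ⟶ f).hom = 𝟙 f.hom := rfl

@[simp] theorem comp_hom₂ {X Y : S.Obj} {f g h : X ⟶ Y} (η : f ⟶ g) (θ : g ⟶ h) :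
    (η ≫ θ).hom = η.hom ≫ θ.hom := rfl

@[simp] theorem eqToHom_hom {X Y : S.Obj} {f g : X ⟶ Y} (h : f = g) :
    (eqToHom h).hom = eqToHom (congrArg Hom.hom h) := by
  subst h; rfl

/-- An invertible 2-cell of the ambient 2-category is one of the sub-2-category. -/
@[simps]
def isoMk {X Y : S.Obj} {f g : X ⟶ Y} (e : f.hom ≅ g.hom) : f ≅ g where
  hom := ⟨e.hom⟩
  inv := ⟨e.inv⟩
  hom_inv_id := hom₂_ext e.hom_inv_id
  inv_hom_id := hom₂_ext e.inv_hom_id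

@[simps! whiskerLeft_hom whiskerRight_hom associator_hom_hom associator_inv_hom
  leftUnitor_hom_hom leftUnitor_inv_hom rightUnitor_hom_hom rightUnitor_inv_hom]
instance : Bicategory S.Obj where
  homCategory X Y := inferInstance
  whiskerLeft f _ _ η := ⟨f.hom ◁ η.hom⟩
  whiskerRight η f := ⟨η.hom ▷ f.hom⟩
  associator f g h := isoMk (α_ f.hom g.hom h.hom)
  leftUnitor f := isoMk (λ_ f.hom)
  rightUnitor f := isoMk (ρ_ f.hom)
  whisker_exchange η θ := hom₂_ext (whisker_exchange η.hom θ.hom)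

instance [Strict B] : Strict S.Obj where
  id_comp f := hom_ext (Strict.id_comp f.hom)
  comp_id f := hom_ext (Strict.comp_id f.hom)
  assoc f g h := hom_ext (Strict.assoc f.hom g.hom h.hom)
  leftUnitor_eqToIso f := by ext; simp [Strict.leftUnitor_eqToIso]
  rightUnitor_eqToIso f := by ext; simp [Strict.rightUnitor_eqToIso]
  associator_eqToIso f g h := by ext; simp [Strict.associator_eqToIso]

end LocallyFullSub

/-- Objects of the strict slice 2-category `B ↓ M` of a strict 2-category `B`:
1-cells of `B` with codomain `M`. -/
structure StrictSlice {B : Type u} [Bicategory.{w, v} B] [Strict B] (M : B) where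
  left : B
  hom : left ⟶ M

namespace StrictSlice

variable {B : Type u} [Bicategory.{w, v} B] [Strict B] {M : B}

/-- 1-cells of the strict slice: strictly commuting triangles. -/
@[ext]
structure Hom (X Y : StrictSlice M) where
  left : X.left ⟶ Y.left
  w : left ≫ Y.hom = X.hom

instance : CategoryStruct (StrictSlice M) where
  Hom X Y := Hom X Y
  id X := ⟨𝟙 X.left, Strict.id_comp _⟩
  comp f g := ⟨f.left ≫ g.left, by rw [Strict.assoc, g.w, f.w]⟩

@[ext]
theorem hom_ext {X Y : StrictSlice M} {f g : X ⟶ Y} (h : f.left = g.left) : f = g := Hom.ext h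

@[simp] theorem id_left (X : StrictSlice M) : (𝟙 X : X ⟶ X).left = 𝟙 X.left := rfl

@[simp] theorem comp_left {X Y Z : StrictSlice M} (f : X ⟶ Y) (g : Y ⟶ Z) :
    (f ≫ g).left = f.left ≫ g.left := rfl

/-- 2-cells of the strict slice: 2-cells of `B` whose whiskering with the structure 1-cell to `M`
is an identity. -/
@[ext]
structure Hom₂ {X Y : StrictSlice M} (f g : X ⟶ Y) where
  left : f.left ⟶ g.left
  w : left ▷ Y.hom = eqToHom (f.w.trans g.w.symm)

instance (X Y : StrictSlice M) : Category (X ⟶ Y) where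
  Hom f g := Hom₂ f g
  id f := ⟨𝟙 f.left, by simp⟩
  comp η θ := ⟨η.left ≫ θ.left, by rw [comp_whiskerRight, η.w, θ.w, eqToHom_trans]⟩
  id_comp η := Hom₂.ext (Category.id_comp η.left)
  comp_id η := Hom₂.ext (Category.comp_id η.left)
  assoc η θ ι := Hom₂.ext (Category.assoc η.left θ.left ι.left)

@[ext]
theorem hom₂_ext {X Y : StrictSlice M} {f g : X ⟶ Y} {η θ : f ⟶ g} (h : η.left = θ.left) :
    η = θ :=
  Hom₂.ext h

@[simp] theorem id_left₂ {X Y : StrictSlice M} (f : X ⟶ Y) :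
    (𝟙 f : f ⟶ f).left = 𝟙 f.left := rfl

@[simp] theorem comp_left₂ {X Y : StrictSlice M} {f g h : X ⟶ Y} (η : f ⟶ g) (θ : g ⟶ h) :
    (η ≫ θ).left = η.left ≫ θ.left := rfl

@[simp] theorem eqToHom_left {X Y : StrictSlice M} {f g : X ⟶ Y} (h : f = g) :
    (eqToHom h).left = eqToHom (congrArg Hom.left h) := by
  subst h; rfl

instance : Bicategory (StrictSlice M) where
  homCategory X Y := inferInstance
  whiskerLeft {X Y Z} f g h η := ⟨f.left ◁ η.left, by
    change (f.left ◁ η.left) ▷ Z.hom = _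
    rw [whisker_assoc, η.w, Strict.associator_eqToIso, Strict.associator_eqToIso,
      whiskerLeft_eqToHom]
    simp⟩
  whiskerRight {X Y Z} f g η h := ⟨η.left ▷ h.left, by
    have e : ∀ {k : Y.left ⟶ M} (_ : k = Y.hom), η.left ▷ k =
        eqToHom (by subst k; exact f.w.trans g.w.symm) := by
      rintro k rfl; exact η.w
    change (η.left ▷ h.left) ▷ Z.hom = _
    have := whiskerRight_comp η.left h.left Z.hom
    rw [e h.w, Strict.associator_eqToIso, Strict.associator_eqToIso] at this
    rw [← cancel_epi (eqToIso (Strict.assoc f.left h.left Z.hom)).inv,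
      ← cancel_mono (eqToIso (Strict.assoc g.left h.left Z.hom)).hom, Category.assoc, ← this]
    simp⟩
  associator f g h := eqToIso (hom_ext (Strict.assoc f.left g.left h.left))
  leftUnitor f := eqToIso (hom_ext (Strict.id_comp f.left))
  rightUnitor f := eqToIso (hom_ext (Strict.comp_id f.left))
  whiskerLeft_id f g := by ext; simp
  whiskerLeft_comp f _ _ _ η θ := by ext; simp
  id_whiskerLeft η := by
    ext
    simp [Strict.leftUnitor_eqToIso]
  comp_whiskerLeft f g _ _ η := by
    ext
    simp [Strict.associator_eqToIso]
  id_whiskerRight f g := by ext; simp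
  comp_whiskerRight η θ i := by ext; simp
  whiskerRight_id η := by
    ext
    simp [Strict.rightUnitor_eqToIso]
  whiskerRight_comp η g h := by
    ext
    simp [Strict.associator_eqToIso]
  whisker_assoc f _ _ η h := by
    ext
    simp [Strict.associator_eqToIso]
  whisker_exchange η θ := by ext; simp [whisker_exchange]
  pentagon f g h i := by ext; simp
  triangle f g := by ext; simp

instance : Strict (StrictSlice M) where
  id_comp f := hom_ext (Strict.id_comp f.left)
  comp_id f := hom_ext (Strict.comp_id f.left)
  assoc f g h := hom_ext (Strict.assoc f.left g.left h.left)
  leftUnitor_eqToIso _ := rfl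
  rightUnitor_eqToIso _ := rfl
  associator_eqToIso _ _ _ := rfl

end StrictSlice

/-- `B` and `C` are equivalent as (strict) 2-categories: there is a strict 2-functor from `B` to `C`
which is an isomorphism on hom-categories and essentially surjective on objects up to
isomorphism. -/
def TwoEquivalent (B : Type u₁) [Bicategory.{w₁, v₁} B] [Strict B]
    (C : Type u₂) [Bicategory.{w₂, v₂} C] [Strict C] : Prop :=
  ∃ F : StrictPseudofunctor B C,
    (∀ X Y : B,
      Function.Bijective (fun f : X ⟶ Y => F.map f) ∧
      ∀ f g : X ⟶ Y, Function.Bijective (fun η : f ⟶ g => F.map₂ η)) ∧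
    ∀ Z : C, ∃ X : B, Nonempty (F.obj X ≅ Z)

namespace CategoryTheory.Pseudofunctor.StrongTrans

variable {B : Type u₁} [Bicategory.{w₁, v₁} B] {K : Type u₂} [Bicategory.{w₂, v₂} K]

theorem ext_of_app {F G : B ⥤ᵖ K} {η θ : F ⟶ G} (h : ∀ a, η.app a = θ.app a)
    (h' : ∀ {a b : B} (f : a ⟶ b), (η.naturality f).hom =
      F.map f ◁ eqToHom (h b) ≫ (θ.naturality f).hom ≫ eqToHom (h a).symm ▷ G.map f) :
    η = θ := by
  obtain ⟨p, n, _, _, _⟩ := η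
  obtain ⟨q, m, _, _, _⟩ := θ
  obtain rfl : p = q := funext h
  obtain rfl : @n = @m := by
    funext a b f
    ext
    simpa using h' f
  rfl

theorem eqToHom_as_app {F G : B ⥤ᵖ K} {η θ : F ⟶ G} (h : η = θ) (a : B) :
    (eqToHom h).as.app a = eqToHom (by rw [h]) := by
  subst h; rfl

theorem eq_of_modification {F G : B ⥤ᵖ K} {η θ : F ⟶ G} (Γ : η ⟶ θ)
    (h : ∀ a, η.app a = θ.app a) (hΓ : ∀ a, Γ.as.app a = eqToHom (h a)) : η = θ :=
  ext_of_app h fun {a b} f => by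
    have := Γ.as.naturality f
    rw [hΓ, hΓ] at this
    rw [reassoc_of% this]
    simp

/-- Pseudofunctors into a strict 2-category, pseudonatural transformations and modifications form
a strict 2-category. -/
instance strict [Strict K] : Strict (B ⥤ᵖ K) where
  id_comp η := eq_of_modification (λ_ η).hom (fun a => Strict.id_comp (η.app a))
    (fun a => congrArg Iso.hom (Strict.leftUnitor_eqToIso (η.app a)))
  comp_id η := eq_of_modification (ρ_ η).hom (fun a => Strict.comp_id (η.app a))
    (fun a => congrArg Iso.hom (Strict.rightUnitor_eqToIso (η.app a)))
  assoc η θ ι := eq_of_modification (α_ η θ ι).hom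
    (fun a => Strict.assoc (η.app a) (θ.app a) (ι.app a))
    (fun a => congrArg Iso.hom (Strict.associator_eqToIso (η.app a) (θ.app a) (ι.app a)))
  leftUnitor_eqToIso η := Iso.ext <| homCategory.ext fun a => by
    rw [eqToIso.hom, eqToHom_as_app]
    exact congrArg Iso.hom (Strict.leftUnitor_eqToIso (η.app a))
  rightUnitor_eqToIso η := Iso.ext <| homCategory.ext fun a => by
    rw [eqToIso.hom, eqToHom_as_app]
    exact congrArg Iso.hom (Strict.rightUnitor_eqToIso (η.app a))
  associator_eqToIso η θ ι := Iso.ext <| homCategory.ext fun a => by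
    rw [eqToIso.hom, eqToHom_as_app]
    exact congrArg Iso.hom (Strict.associator_eqToIso (η.app a) (θ.app a) (ι.app a))

end CategoryTheory.Pseudofunctor.StrongTrans

/-! ### Limit cones -/

/-- A functor `T : J ⥤ k ↓ K`, viewed as a cone with vertex `k` over the diagram `cod ∘ T`. -/
@[simps]
def coneOfUnder {J : Type u₁} [Category.{v₁} J] {K : Type u₂} [Category.{v₂} K] {k : K}
    (T : J ⥤ Under k) : Limits.Cone (T ⋙ Under.forget k) where
  pt := k
  π :=
    { app := fun j => (T.obj j).hom
      naturality := fun i j f => by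
        change 𝟙 k ≫ (T.obj j).hom = (T.obj i).hom ≫ (T.map f).right
        rw [Category.id_comp]
        exact (Under.w (T.map f)).symm }

section

variable {J : Type u₁} [Category.{v₁} J] {K : Type u₂} [Bicategory.{w₂, v₂} K] [Strict K] {k : K}

/-- The projection at `j` of the cone `T`. -/
def coneLeg (T : J ⥤ Under k) (j : J) : k ⟶ (T.obj j).right := (T.obj j).hom

/-- The transition 1-cells of the diagram underlying the cone `T`. -/
def coneTransition (T : J ⥤ Under k) {i j : J} (f : i ⟶ j) :
    (T.obj i).right ⟶ (T.obj j).right := (T.map f).right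

theorem coneLeg_transition (T : J ⥤ Under k) {i j : J} (f : i ⟶ j) :
    coneLeg T i ≫ coneTransition T f = coneLeg T j := Under.w (T.map f)

theorem comp_coneLeg_transition (T : J ⥤ Under k) {i j : J} (f : i ⟶ j) {X : K} (l : X ⟶ k) :
    (l ≫ coneLeg T i) ≫ coneTransition T f = l ≫ coneLeg T j := by
  rw [Strict.assoc, coneLeg_transition]

/-- The cone `T` is a limit cone in the strict 2-category `K` (a strict conical 2-limit): for each
`X`, composing with the projections is an isomorphism from the category `X ⟶ k` onto the category
of cones with vertex `X` and modifications between them. The first clause is bijectivity on objects,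
the second one is bijectivity on morphisms. -/
def IsTwoLimitCone (T : J ⥤ Under k) : Prop :=
  Nonempty (Limits.IsLimit (coneOfUnder T)) ∧
  ∀ (X : K) (l m : X ⟶ k) (θ : ∀ j : J, l ≫ coneLeg T j ⟶ m ≫ coneLeg T j),
    (∀ {i j : J} (f : i ⟶ j),
      θ i ▷ coneTransition T f ≫ eqToHom (comp_coneLeg_transition T f m) =
        eqToHom (comp_coneLeg_transition T f l) ≫ θ j) →
    ∃! η : l ⟶ m, ∀ j : J, η ▷ coneLeg T j = θ j

end

/-! ### Locally discrete `𝓕`-sketches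

A locally discrete `𝓕`-category is a category `C` (regarded as the 2-category `LocallyDiscrete C`)
with a class of morphisms, the inerts, containing the identities and closed under composition. -/

/-- A cone with vertex `a` indexed by a strict 2-category `J`, in the locally discrete
`𝓕`-category `C` with class of inerts `W`: a strict 2-functor `J ⥤ a ↓ C_inert`. As the target has
only identity 2-cells, this is a functor on the underlying category of `J` which identifies 1-cells
that are connected by a 2-cell. -/
structure FCone {C : Type u} [Category.{v} C] (W : MorphismProperty C) [W.IsMultiplicative]
    (J : Type uJ) [Bicategory.{wJ, vJ} J] [Strict J] (a : C) where
  functor : J ⥤ Under (WideSubcategory.mk a : WideSubcategory W)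
  map_eq_of_hom₂ : ∀ {i j : J} {f g : i ⟶ j}, (f ⟶ g) → functor.map f = functor.map g

/-- A functor `F : C ⥤ D` restricts to a functor between the wide subcategories of inerts, for the
inerts in `C` being the morphisms sent by `F` to inerts. -/
@[simps]
def wideFunctor {C : Type u₁} [Category.{v₁} C] {D : Type u₂} [Category.{v₂} D]
    (W : MorphismProperty D) [W.IsMultiplicative] (F : C ⥤ D) :
    WideSubcategory (W.inverseImage F) ⥤ WideSubcategory W where
  obj x := ⟨F.obj x.obj⟩
  map f := ⟨F.map f.hom, f.property⟩
  map_id x := WideSubcategory.hom_ext _ (F.map_id x.obj)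
  map_comp f g := WideSubcategory.hom_ext _ (F.map_comp f.hom g.hom)

/-- The image of a cone under a functor. -/
def FCone.image {C : Type u₁} [Category.{v₁} C] {D : Type u₂} [Category.{v₂} D]
    {W : MorphismProperty D} [W.IsMultiplicative] (F : C ⥤ D)
    {J : Type uJ} [Bicategory.{wJ, vJ} J] [Strict J] {x : C}
    (S : FCone (W.inverseImage F) J x) : FCone W J (F.obj x) where
  functor := S.functor ⋙ Under.post (wideFunctor W F)
  map_eq_of_hom₂ η := congrArg (Under.post (wideFunctor W F)).map (S.map_eq_of_hom₂ η)

set_option linter.checkUnivs false in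
/-- A locally discrete `𝓕`-sketch with underlying category `C`: a class of inert morphisms and a
collection of marked cones. -/
structure FSketch (C : Type u) [Category.{v} C] where
  inert : MorphismProperty C
  [isMultiplicative : inert.IsMultiplicative]
  marked : ∀ (J : Type uJ) [Bicategory.{wJ, vJ} J] [Strict J] (a : C), FCone inert J a → Prop

attribute [instance] FSketch.isMultiplicative

/-! ### Pseudo-`𝓕`-functors and pseudo-models

A 2-category `K` is regarded as a chordate `𝓕`-category: all its 1-cells are inert. -/

section

variable {C : Type u} [Category.{v} C] (W : MorphismProperty C) {K : Type u₂}
  [Bicategory.{w₂, v₂} K]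

/-- A pseudofunctor is a pseudo-`𝓕`-functor if its unitors are identities and its compositors are
identities whenever one of the two composed morphisms is inert. -/
structure IsPseudoFFunctor (P : LocallyDiscrete C ⥤ᵖ K) : Prop where
  mapId_eq : ∀ a : LocallyDiscrete C, ∃ h : P.map (𝟙 a) = 𝟙 (P.obj a), P.mapId a = eqToIso h
  mapComp_eq : ∀ {a b c : C} (f : a ⟶ b) (g : b ⟶ c), W f ∨ W g →
    ∃ h : P.map (f.toLoc ≫ g.toLoc) = P.map f.toLoc ≫ P.map g.toLoc,
      P.mapComp f.toLoc g.toLoc = eqToIso h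

/-- A pseudonatural transformation is a pseudo-`𝓕`-transformation if its naturality cells at inert
morphisms are identities. -/
def IsPseudoFTrans {P Q : LocallyDiscrete C ⥤ᵖ K} (α : P ⟶ Q) : Prop :=
  ∀ {a b : C} (f : a ⟶ b), W f →
    ∃ h : P.map f.toLoc ≫ α.app ⟨b⟩ = α.app ⟨a⟩ ≫ Q.map f.toLoc, α.naturality f.toLoc = eqToIso h

variable {W} [W.IsMultiplicative] [Strict K]

/-- The restriction of a pseudo-`𝓕`-functor to inert morphisms is a strict functor. -/
@[simps]
def IsPseudoFFunctor.inertFunctor {P : LocallyDiscrete C ⥤ᵖ K} (hP : IsPseudoFFunctor W P) :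
    WideSubcategory W ⥤ K where
  obj a := P.obj ⟨a.obj⟩
  map f := P.map f.hom.toLoc
  map_id a := (hP.mapId_eq ⟨a.obj⟩).1
  map_comp f g := (hP.mapComp_eq f.hom g.hom (Or.inl f.property)).1

end

namespace FSketch

variable {C : Type u} [Category.{v} C] (A : FSketch.{uJ, vJ, wJ} C)

/-- A pseudo-`𝓕`-functor is a pseudo-model in the 2-category `K` if for each marked cone `S` the
composite of `S : J ⥤ a ↓ C_inert` with the functor `a ↓ C_inert ⥤ P a ↓ K` given by `P` is a limit
cone in `K`. -/
structure IsPseudoModel {K : Type u₂} [Bicategory.{w₂, v₂} K] [Strict K]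
    (P : LocallyDiscrete C ⥤ᵖ K) : Prop where
  isPseudoFFunctor : IsPseudoFFunctor A.inert P
  isTwoLimitCone : ∀ (J : Type uJ) [Bicategory.{wJ, vJ} J] [Strict J] (a : C)
    (S : FCone A.inert J a), A.marked J a S →
      IsTwoLimitCone (S.functor ⋙ Under.post isPseudoFFunctor.inertFunctor)

/-- The pseudo-models, pseudo-`𝓕`-transformations (and all modifications) form a locally full
sub-2-category of the 2-category of pseudofunctors. -/
def psModSub (K : Type u₂) [Bicategory.{w₂, v₂} K] [Strict K] :
    LocallyFullSub (LocallyDiscrete C ⥤ᵖ K) where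
  objProp P := A.IsPseudoModel P
  homProp α := IsPseudoFTrans A.inert α
  id_mem P _ a b f _ := by
    refine ⟨(Strict.comp_id _).trans (Strict.id_comp _).symm, ?_⟩
    change ρ_ (P.map f.toLoc) ≪≫ (λ_ (P.map f.toLoc)).symm = _
    rw [Strict.leftUnitor_eqToIso, Strict.rightUnitor_eqToIso]
    exact Iso.ext (eqToHom_trans (Strict.comp_id (P.map f.toLoc)) (Strict.id_comp (P.map f.toLoc)).symm)
  comp_mem {P Q R} α β _ _ _ hα hβ a b f hf := by
    obtain ⟨h, e⟩ := hα f hf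
    obtain ⟨h', e'⟩ := hβ f hf
    refine ⟨?_, ?_⟩
    · change P.map f.toLoc ≫ α.app ⟨b⟩ ≫ β.app ⟨b⟩ = (α.app ⟨a⟩ ≫ β.app ⟨a⟩) ≫ R.map f.toLoc
      rw [← Strict.assoc, h, Strict.assoc, h', Strict.assoc]
    · ext
      rw [Pseudofunctor.StrongTrans.categoryStruct_comp_naturality_hom, e, e']
      simp only [Strict.associator_eqToIso, eqToIso.hom, eqToIso.inv, eqToHom_whiskerRight,
        whiskerLeft_eqToHom]
      erw [eqToHom_trans, eqToHom_trans, eqToHom_trans, eqToHom_trans]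
      rfl

/-- The 2-category of pseudo-models of `A` in `K`, pseudo-`𝓕`-transformations and modifications. -/
abbrev PsMod (K : Type u₂) [Bicategory.{w₂, v₂} K] [Strict K] := (A.psModSub K).Obj

/-- A functor `M : C ⥤ Type w` is a (strict) set-valued model if it sends marked cones to limit
cones. -/
def IsSetModel (M : C ⥤ Type w) : Prop :=
  ∀ (J : Type uJ) [Bicategory.{wJ, vJ} J] [Strict J] (a : C) (S : FCone A.inert J a),
    A.marked J a S →
      Nonempty (Limits.IsLimit (coneOfUnder
        (S.functor ⋙ Under.post (wideSubcategoryInclusion A.inert ⋙ M))))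

/-- The `𝓕`-sketch structure on the category of elements of `M`: a morphism is inert iff the
underlying morphism of `C` is, and a cone is marked iff its projection to `C` is. -/
def elements (M : C ⥤ Type w) : FSketch.{uJ, vJ, wJ} M.Elements where
  inert := A.inert.inverseImage (CategoryOfElements.π M)
  marked J _ _ x S := A.marked J x.1 (S.image (CategoryOfElements.π M))

/-- A set-valued functor, regarded as a pseudofunctor into `Cat` with values the discrete
categories. -/
def discretePseudofunctor (M : C ⥤ Type w) : LocallyDiscrete C ⥤ᵖ Cat.{w, w} :=
  (M ⋙ typeToCat).toPseudofunctor'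

theorem isPseudoFFunctor_discrete (W : MorphismProperty C) (M : C ⥤ Type w) :
    IsPseudoFFunctor W (discretePseudofunctor M) where
  mapId_eq _ := ⟨_, rfl⟩
  mapComp_eq _ _ _ := ⟨_, rfl⟩

theorem isPseudoModel_discrete {M : C ⥤ Type w} (hM : A.IsSetModel M) :
    A.IsPseudoModel (discretePseudofunctor M) where
  isPseudoFFunctor := isPseudoFFunctor_discrete A.inert M
  isTwoLimitCone J _ _ a S hS := by
    obtain ⟨hL⟩ := hM J a S hS
    have inj : ∀ x y : M.obj a,
        (∀ j, M.map (S.functor.obj j).hom.hom x = M.map (S.functor.obj j).hom.hom y) → x = y := by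
      intro x y h
      have := hL.hom_ext (f := ↾fun _ : PUnit.{w + 1} => x) (f' := ↾fun _ => y) (fun j => by
        ext; exact h j)
      exact ConcreteCategory.congr_hom this PUnit.unit
    refine ⟨⟨?_⟩, ?_⟩
    · -- the projections of a cone with vertex `X` in `Cat` are families of elements of `M`
      let t (s : Limits.Cone ((S.functor ⋙ Under.post
          (isPseudoFFunctor_discrete A.inert M).inertFunctor) ⋙ Under.forget _)) (j : J) :
          s.pt ⥤ Discrete (M.obj (S.functor.obj j).right.obj) := (s.π.app j).toFunctor
      have ex (s : Limits.Cone ((S.functor ⋙ Under.post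
          (isPseudoFFunctor_discrete A.inert M).inertFunctor) ⋙ Under.forget _)) :
          ∃ g : s.pt → M.obj a, ∀ j z,
          M.map (S.functor.obj j).hom.hom (g z) = ((t s j).obj z).as := by
        let c : Limits.Cone ((S.functor ⋙ Under.post
            (wideSubcategoryInclusion A.inert ⋙ M)) ⋙ Under.forget _) :=
          { pt := s.pt
            π :=
              { app := fun j => ↾fun z => ((t s j).obj z).as
                naturality := fun i j f => by
                  ext z
                  exact (congrArg Discrete.as
                    (Functor.congr_obj (congrArg Cat.Hom.toFunctor (s.w f)) z)).symm } }
        exact ⟨hL.lift c, fun j z => ConcreteCategory.congr_hom (hL.fac c j) z⟩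
      choose g hg using ex
      have gmap (s : Limits.Cone ((S.functor ⋙ Under.post
          (isPseudoFFunctor_discrete A.inert M).inertFunctor) ⋙ Under.forget _)) {z z' : s.pt} (f : z ⟶ z') : g s z = g s z' := inj _ _ fun j => by
        rw [hg, hg]
        exact Discrete.eq_of_hom ((t s j).map f)
      let l (s : Limits.Cone ((S.functor ⋙ Under.post
          (isPseudoFFunctor_discrete A.inert M).inertFunctor) ⋙ Under.forget _)) : s.pt ⥤ Discrete (M.obj a) :=
        { obj := fun z => ⟨g s z⟩
          map := fun f => Discrete.eqToHom (gmap s f)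
          map_id := fun _ => Subsingleton.elim _ _
          map_comp := fun _ _ => Subsingleton.elim _ _ }
      have fext {X : Type w} [Category.{w} X] {Y : Type w} (F G : X ⥤ Discrete Y)
          (h : ∀ x : X, (F.obj x).as = (G.obj x).as) : F = G :=
        CategoryTheory.Functor.ext (fun x => Discrete.ext (h x)) (fun _ _ _ => Subsingleton.elim _ _)
      exact
        { lift := fun s => (l s).toCatHom
          fac := fun s j => Cat.ext (fext _ _ fun z => hg s j z)
          uniq := fun s m hm => Cat.ext (fext _ _ fun z => inj _ _ fun j => by
            exact (congrArg Discrete.as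
              (Functor.congr_obj (congrArg Cat.Hom.toFunctor (hm j)) z)).trans (hg s j z).symm) }
    · intro X l m θ _
      have key (z : X) : l.toFunctor.obj z = m.toFunctor.obj z :=
        Discrete.ext (inj _ _ fun j => Discrete.eq_of_hom ((θ j).toNatTrans.app z))
      have sub {Y : Type w} {F G : X ⟶ Cat.of (Discrete Y)} (η η' : F ⟶ G) : η = η' :=
        Cat.Hom₂.ext (NatTrans.ext (funext fun z => (Discrete.instSubsingletonDiscreteHom
          (α := Y) (F.toFunctor.obj z) (G.toFunctor.obj z)).elim _ _))
      exact ⟨⟨{ app := fun z => eqToHom (key z)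
                naturality := fun _ _ _ => (Discrete.instSubsingletonDiscreteHom (α := M.obj a) _ _).elim _ _ }⟩,
        fun j => sub _ _, fun _ _ => sub (Y := M.obj a) _ _⟩

/-- A set-valued model, regarded as a discrete pseudo-model in `Cat`. -/
def discreteModel (M : C ⥤ Type w) (hM : A.IsSetModel M) : A.PsMod Cat.{w, w} :=
  ⟨discretePseudofunctor M, A.isPseudoModel_discrete hM⟩

end FSketch

/-!
A pseudonatural transformation `p : P ⟶ M` to a functor with discrete values amounts to a
labelling of the objects of each category `P a` by elements of `M a`, constant along morphisms and
compatible with the action of the morphisms of `C`: all the cells of `p` lie in discrete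
categories, so they are equalities. Hence `P a` is the disjoint union, over `x : M a`, of the full
subcategories `Fibre p x` of objects of index `x`, and a morphism `f : x ⟶ y` of elements of `M`
restricts to a functor `Fibre p x ⥤ Fibre p y`. This gives the pseudofunctor `fibre` on the
category of elements, whose unitors and compositors are the restrictions of those of `P`, so that
it is a pseudo-`𝓕`-functor.

The 2-functor of the theorem, `fibreFunctor`, sends `(P, p)` to `fibre`. It is bijective on
1-cells and 2-cells, since functors and natural transformations over `M` are glued uniquely from
their restrictions to the fibres (`fibreTrans_injective`, `exists_fibreTrans_eq`,
`fibreHom_bijective`); the slice condition on 2-cells is automatic, as parallel 2-cells into a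
discrete category are equal. It is essentially surjective because a pseudofunctor `Q` on the
category of elements is isomorphic to the fibres of its total pseudofunctor
`a ↦ Σ x : M a, Q (a, x)` (`exists_iso_fibre_total`).

It remains to see that `P` is a pseudo-model if and only if its fibres form one. A strict 2-limit
cone in `Cat` is described by objects and morphisms (`IsCatLimit`). Given a marked cone `S` with
vertex `a`, its lifts to the category of elements are indexed by the elements `x : M a`, and their
images under the pseudofunctor of fibres are full subcones of the image of `S` under `P`
(`FibreEmbedding.coneEmbedding`). Since `M` is a model, the index of an object of `P a` is
determined by the indices of its projections, and the indices of a compatible family come from an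
element of `M a`. So each lift inherits the limit property
(`FibreEmbedding.isPseudoModel_elements`), and conversely compatible data over the
image of `S` lie over a single one of its lifts (`FibreEmbedding.isPseudoModel`).

Both constructions are strictly unitary, and their cells are compared up to equality of objects;
for this, heterogeneous equality of morphisms is used throughout.
-/

/-! ### Morphisms up to equality of objects, and `Cat`-valued pseudofunctors by components -/

namespace CategoryTheory

section

variable {X : Type u₁} [Category.{v₁} X] {Y : Type u₂} [Category.{v₂} Y]

theorem Functor.map_heq_map (F : X ⥤ Y) {a b a' b' : X} {f : a ⟶ b} {f' : a' ⟶ b'}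
    (ha : a = a') (hb : b = b') (hf : f ≍ f') : F.map f ≍ F.map f' := by
  subst ha hb hf; rfl

theorem exists_eq_eqToHom_of_heq {a b a' b' : X} {f : a ⟶ b} {f' : a' ⟶ b'} (ha : a = a')
    (hb : b = b') (hf : f ≍ f') (h : ∃ h, f' = eqToHom h) : ∃ h, f = eqToHom h := by
  subst ha hb hf; exact h

/-- Identity morphisms are heterogeneously equal as soon as their endpoints agree; this is how the
identity cells of two different constructions are compared. -/
theorem heq_of_eq_eqToHom {a b a' b' : X} {f : a ⟶ b} {f' : a' ⟶ b'} (ha : a = a')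
    (hb : b = b') (hf : ∃ h, f = eqToHom h) (hf' : ∃ h, f' = eqToHom h) : f ≍ f' := by
  subst ha hb
  obtain ⟨h, rfl⟩ := hf
  obtain ⟨_, rfl⟩ := hf'
  rfl

theorem Functor.map_heq_of_eq {F G : X ⥤ Y} (h : F = G) {x y : X} (f : x ⟶ y) :
    F.map f ≍ G.map f := by
  subst h; rfl

theorem ObjectProperty.hom_heq_hom {P : ObjectProperty X} {a b a' b' : P.FullSubcategory}
    {f : a ⟶ b} {f' : a' ⟶ b'} (ha : a = a') (hb : b = b') (hf : f ≍ f') : f.hom ≍ f'.hom := by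
  subst ha hb hf; rfl

theorem ObjectProperty.heq_of_hom_heq_hom {P : ObjectProperty X} {a b a' b' : P.FullSubcategory}
    {f : a ⟶ b} {f' : a' ⟶ b'} (ha : a = a') (hb : b = b') (hf : f.hom ≍ f'.hom) : f ≍ f' := by
  subst ha hb; exact heq_of_eq (InducedCategory.Hom.ext (eq_of_heq hf))

end

/-- An invertible 2-cell of `Cat` is an identity if its components are; the equality of the
underlying functors is part of the conclusion. -/
theorem Cat.exists_eq_eqToIso {X Y : Cat.{v₁, u₁}} {F G : X ⟶ Y} (e : F ≅ G)
    (h : ∀ z : X, ∃ h : F.toFunctor.obj z = G.toFunctor.obj z,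
      e.hom.toNatTrans.app z = eqToHom h) :
    ∃ h : F = G, e = eqToIso h := by
  have hF : F = G := Cat.ext
    (Functor.ext_of_iso (Cat.Hom.toNatIso e) (fun z => (h z).1) (fun z => (h z).2))
  refine ⟨hF, Iso.ext (Cat.Hom₂.ext (NatTrans.ext (funext fun z => ?_)))⟩
  obtain ⟨_, hz⟩ := h z
  rw [hz]
  simp

theorem Cat.app_eqToIso {X Y : Cat.{v₁, u₁}} {F G : X ⟶ Y} {e : F ≅ G}
    (h : ∃ h : F = G, e = eqToIso h) (z : X) :
    ∃ h : F.toFunctor.obj z = G.toFunctor.obj z, e.hom.toNatTrans.app z = eqToHom h := by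
  obtain ⟨rfl, rfl⟩ := h
  exact ⟨rfl, by simp⟩

namespace Pseudofunctor

variable {C : Type u} [Category.{v} C]

theorem map₂_toNatTrans_app (P : LocallyDiscrete C ⥤ᵖ Cat.{v₁, u₁}) {a b : LocallyDiscrete C}
    {f g : a ⟶ b} (η : f ⟶ g) (z : P.obj a) :
    (P.map₂ η).toNatTrans.app z =
      eqToHom (by rw [LocallyDiscrete.eq_of_hom η]) := by
  obtain rfl := LocallyDiscrete.eq_of_hom η
  obtain rfl : η = 𝟙 f := Subsingleton.elim _ _
  simp

theorem mapComp_assoc_app (P : LocallyDiscrete C ⥤ᵖ Cat.{v₁, u₁}) {a b c d : LocallyDiscrete C}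
    (f : a ⟶ b) (g : b ⟶ c) (h : c ⟶ d) (z : P.obj a) :
    (P.mapComp (f ≫ g) h).hom.toNatTrans.app z ≫
        (P.map h).toFunctor.map ((P.mapComp f g).hom.toNatTrans.app z) =
      eqToHom (by rw [Strict.assoc]) ≫ (P.mapComp f (g ≫ h)).hom.toNatTrans.app z ≫
        (P.mapComp g h).hom.toNatTrans.app ((P.map f).toFunctor.obj z) := by
  have := congr_app (congrArg Cat.Hom₂.toNatTrans (P.map₂_associator f g h)) z
  simp only [Cat.Hom.toNatTrans_comp, NatTrans.comp_app, map₂_toNatTrans_app,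
    Cat.whiskerLeft_app, Cat.whiskerRight_app, Cat.associator_hom_app] at this
  rw [this]
  simp

namespace StrongTrans

variable {P Q : LocallyDiscrete C ⥤ᵖ Cat.{v₁, u₁}}

theorem naturality_comp_app (α : P ⟶ Q) {a b c : LocallyDiscrete C}
    (f : a ⟶ b) (g : b ⟶ c) (z : P.obj a) :
    (α.naturality (f ≫ g)).hom.toNatTrans.app z ≫
        (Q.mapComp f g).hom.toNatTrans.app ((α.app a).toFunctor.obj z) =
      (α.app c).toFunctor.map ((P.mapComp f g).hom.toNatTrans.app z) ≫
        (α.naturality g).hom.toNatTrans.app ((P.map f).toFunctor.obj z) ≫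
          (Q.map g).toFunctor.map ((α.naturality f).hom.toNatTrans.app z) := by
  have := congr_app (congrArg Cat.Hom₂.toNatTrans (α.naturality_comp f g)) z
  simp only [Cat.Hom.toNatTrans_comp, NatTrans.comp_app, Cat.whiskerLeft_app,
    Cat.whiskerRight_app, Cat.associator_hom_app, Cat.associator_inv_app] at this
  rw [this]
  simp

theorem naturality_app_congr {α β : P ⟶ Q} (h : α = β) {a b : LocallyDiscrete C} (f : a ⟶ b)
    (z : P.obj a) :
    (α.naturality f).hom.toNatTrans.app z ≍ (β.naturality f).hom.toNatTrans.app z := by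
  subst h; rfl

theorem ext_of_components {α β : P ⟶ Q} (h : ∀ a, (α.app a).toFunctor = (β.app a).toFunctor)
    (h' : ∀ {a b : LocallyDiscrete C} (f : a ⟶ b) (z : P.obj a),
      (α.naturality f).hom.toNatTrans.app z ≍ (β.naturality f).hom.toNatTrans.app z) : α = β :=
  ext_of_app (fun a => Cat.ext (h a)) fun f => Cat.Hom₂.ext <| NatTrans.ext <| funext fun z => by
    rw [(conj_eqToHom_iff_heq _ _ (by simp [h]) (by simp [h])).2 (h' f z)]
    simp

/-- A pseudonatural transformation of strictly unitary `Cat`-valued pseudofunctors on a category,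
in terms of the components of its structure cells. -/
@[simps]
def ofComponents
    (hP : ∀ a, ∃ h : P.map (𝟙 a) = 𝟙 (P.obj a), P.mapId a = eqToIso h)
    (hQ : ∀ a, ∃ h : Q.map (𝟙 a) = 𝟙 (Q.obj a), Q.mapId a = eqToIso h)
    (app : ∀ a, P.obj a ⟶ Q.obj a)
    (naturality : ∀ {a b : LocallyDiscrete C} (f : a ⟶ b), P.map f ≫ app b ≅ app a ≫ Q.map f)
    (naturality_id : ∀ (a : LocallyDiscrete C) (z : P.obj a),
      ∃ h, (naturality (𝟙 a)).hom.toNatTrans.app z = eqToHom h)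
    (naturality_comp : ∀ {a b c : LocallyDiscrete C} (f : a ⟶ b) (g : b ⟶ c) (z : P.obj a),
      (naturality (f ≫ g)).hom.toNatTrans.app z ≫
          (Q.mapComp f g).hom.toNatTrans.app ((app a).toFunctor.obj z) =
        (app c).toFunctor.map ((P.mapComp f g).hom.toNatTrans.app z) ≫
          (naturality g).hom.toNatTrans.app ((P.map f).toFunctor.obj z) ≫
            (Q.map g).toFunctor.map ((naturality f).hom.toNatTrans.app z)) : P ⟶ Q where
  app := app
  naturality := naturality
  naturality_naturality η := by
    obtain rfl := LocallyDiscrete.eq_of_hom η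
    obtain rfl : η = 𝟙 _ := Subsingleton.elim _ _
    simp
  naturality_id a := Cat.Hom₂.ext <| NatTrans.ext <| funext fun z => by
    simp only [Cat.Hom.toNatTrans_comp, NatTrans.comp_app, Cat.whiskerLeft_app,
      Cat.whiskerRight_app, Cat.leftUnitor_hom_app, Cat.rightUnitor_inv_app]
    rw [(naturality_id a z).2, (Cat.app_eqToIso (hP a) z).2,
      (Cat.app_eqToIso (hQ a) _).2, eqToHom_map]
    simp
  naturality_comp f g := Cat.Hom₂.ext <| NatTrans.ext <| funext fun z => by
    simp only [Cat.Hom.toNatTrans_comp, NatTrans.comp_app, Cat.whiskerLeft_app,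
      Cat.whiskerRight_app, Cat.associator_hom_app, Cat.associator_inv_app]
    rw [naturality_comp]
    simp

theorem modification_naturality_app {α β : P ⟶ Q} (Γ : α ⟶ β) {a b : LocallyDiscrete C}
    (f : a ⟶ b) (z : P.obj a) :
    (Γ.as.app b).toNatTrans.app ((P.map f).toFunctor.obj z) ≫
        (β.naturality f).hom.toNatTrans.app z =
      (α.naturality f).hom.toNatTrans.app z ≫
        (Q.map f).toFunctor.map ((Γ.as.app a).toNatTrans.app z) :=
  congr_app (congrArg Cat.Hom₂.toNatTrans (Γ.as.naturality f)) z

/-- A modification of `Cat`-valued pseudofunctors, in terms of the components. -/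
@[simps]
def homOfComponents {α β : P ⟶ Q} (app : ∀ a, α.app a ⟶ β.app a)
    (naturality : ∀ {a b : LocallyDiscrete C} (f : a ⟶ b) (z : P.obj a),
      (app b).toNatTrans.app ((P.map f).toFunctor.obj z) ≫
        (β.naturality f).hom.toNatTrans.app z =
      (α.naturality f).hom.toNatTrans.app z ≫
        (Q.map f).toFunctor.map ((app a).toNatTrans.app z)) : α ⟶ β where
  as :=
    { app := app
      naturality f := Cat.Hom₂.ext <| NatTrans.ext <| funext fun z => naturality f z }

theorem hom_ext_of_components {α β : P ⟶ Q} {Γ Θ : α ⟶ β}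
    (h : ∀ a (z : P.obj a), (Γ.as.app a).toNatTrans.app z = (Θ.as.app a).toNatTrans.app z) :
    Γ = Θ :=
  homCategory.ext fun a => Cat.Hom₂.ext <| NatTrans.ext <| funext fun z => h a z

end StrongTrans

section

variable (obj : C → Cat.{v₁, u₁}) (map : ∀ {a b : C}, (a ⟶ b) → (obj a ⟶ obj b))
  (map_id : ∀ a, map (𝟙 a) = 𝟙 (obj a))
  (mapComp : ∀ {a b c : C} (f : a ⟶ b) (g : b ⟶ c), map (f ≫ g) ≅ map f ≫ map g)

/-- A strictly unitary `Cat`-valued pseudofunctor on a category, in terms of the components of its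
compositors. -/
@[simps! obj map mapId mapComp]
def ofComponents
    (mapComp_assoc : ∀ {a b c d : C} (f : a ⟶ b) (g : b ⟶ c) (h : c ⟶ d) (z : obj a),
      (mapComp (f ≫ g) h).hom.toNatTrans.app z ≫
          (map h).toFunctor.map ((mapComp f g).hom.toNatTrans.app z) =
        eqToHom (by rw [Category.assoc]) ≫ (mapComp f (g ≫ h)).hom.toNatTrans.app z ≫
          (mapComp g h).hom.toNatTrans.app ((map f).toFunctor.obj z))
    (id_mapComp : ∀ {a b : C} (f : a ⟶ b) (z : obj a), (mapComp (𝟙 a) f).hom.toNatTrans.app z =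
      eqToHom (by rw [Category.id_comp, map_id]; rfl))
    (mapComp_id : ∀ {a b : C} (f : a ⟶ b) (z : obj a), (mapComp f (𝟙 b)).hom.toNatTrans.app z =
      eqToHom (by rw [Category.comp_id, map_id]; rfl)) :
    LocallyDiscrete C ⥤ᵖ Cat.{v₁, u₁} :=
  LocallyDiscrete.mkPseudofunctor obj map (fun a => eqToIso (map_id a)) mapComp
    (fun f g h => Cat.Hom₂.ext <| NatTrans.ext <| funext fun z => by
      have := mapComp_assoc f g h z
      simp only [Cat.Hom.toNatTrans_comp, NatTrans.comp_app, Cat.whiskerLeft_app,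
        Cat.whiskerRight_app, Cat.associator_hom_app]
      rw [reassoc_of% this]
      simp)
    (fun f => Cat.Hom₂.ext <| NatTrans.ext <| funext fun z => by
      simp only [Cat.Hom.toNatTrans_comp, NatTrans.comp_app, id_mapComp,
        Cat.whiskerRight_app, Cat.leftUnitor_hom_app]
      simp [eqToHom_map])
    (fun f => Cat.Hom₂.ext <| NatTrans.ext <| funext fun z => by
      simp only [Cat.Hom.toNatTrans_comp, NatTrans.comp_app, mapComp_id,
        Cat.whiskerLeft_app, Cat.rightUnitor_hom_app]
      simp)

end

end Pseudofunctor

end CategoryTheory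

/-! ### Pseudo-`𝓕`-functors and pseudo-`𝓕`-transformations by components -/

section

variable {C : Type u} [Category.{v} C] {W : MorphismProperty C}

theorem IsPseudoFFunctor.of_components {P : LocallyDiscrete C ⥤ᵖ Cat.{v₁, u₁}}
    (mapId_eq : ∀ a : LocallyDiscrete C, ∃ h : P.map (𝟙 a) = 𝟙 (P.obj a), P.mapId a = eqToIso h)
    (mapComp_app : ∀ {a b c : C} (f : a ⟶ b) (g : b ⟶ c), W f ∨ W g → ∀ z : P.obj ⟨a⟩,
      ∃ h, (P.mapComp f.toLoc g.toLoc).hom.toNatTrans.app z = eqToHom h) :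
    IsPseudoFFunctor W P where
  mapId_eq := mapId_eq
  mapComp_eq f g h := Cat.exists_eq_eqToIso _ (mapComp_app f g h)

theorem IsPseudoFFunctor.mapComp_app {P : LocallyDiscrete C ⥤ᵖ Cat.{v₁, u₁}}
    (hP : IsPseudoFFunctor W P) {a b c : C} (f : a ⟶ b) (g : b ⟶ c) (h : W f ∨ W g)
    (z : P.obj ⟨a⟩) : ∃ h, (P.mapComp f.toLoc g.toLoc).hom.toNatTrans.app z = eqToHom h :=
  Cat.app_eqToIso (hP.mapComp_eq f g h) z

theorem IsPseudoFFunctor.map_id_obj {P : LocallyDiscrete C ⥤ᵖ Cat.{v₁, u₁}}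
    (hP : IsPseudoFFunctor W P) (a : LocallyDiscrete C) (z : P.obj a) :
    (P.map (𝟙 a)).toFunctor.obj z = z := by
  rw [(hP.mapId_eq a).1]; rfl

theorem isPseudoFTrans_of_components {P Q : LocallyDiscrete C ⥤ᵖ Cat.{v₁, u₁}} (α : P ⟶ Q)
    (h : ∀ {a b : C} (f : a ⟶ b), W f → ∀ z : P.obj ⟨a⟩,
      ∃ h, (α.naturality f.toLoc).hom.toNatTrans.app z = eqToHom h) : IsPseudoFTrans W α :=
  fun f hf => Cat.exists_eq_eqToIso _ (h f hf)

theorem naturality_app_of_isPseudoFTrans {P Q : LocallyDiscrete C ⥤ᵖ Cat.{v₁, u₁}} {α : P ⟶ Q}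
    (hα : IsPseudoFTrans W α) {a b : C} (f : a ⟶ b) (hf : W f) (z : P.obj ⟨a⟩) :
    ∃ h, (α.naturality f.toLoc).hom.toNatTrans.app z = eqToHom h :=
  Cat.app_eqToIso (hα f hf) z

end

/-! ### Fibres of a pseudofunctor over a discrete one -/

namespace FSketch

section

variable {C : Type u} [Category.{v} C] {M : C ⥤ Type w}

theorem discrete_hom₂_ext {X : Cat.{w, w}} {a : LocallyDiscrete C}
    {F G : X ⟶ (discretePseudofunctor M).obj a} (η θ : F ⟶ G) : η = θ :=
  Cat.Hom₂.ext <| NatTrans.ext <| funext fun _ =>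
    (Discrete.instSubsingletonDiscreteHom (α := M.obj a.as) _ _).elim _ _

variable {P Q : LocallyDiscrete C ⥤ᵖ Cat.{w, w}}

/-- The element of `M` over which an object of a value of `P` lies. -/
def index (p : P ⟶ discretePseudofunctor M) {a : C} (z : P.obj ⟨a⟩) : M.obj a :=
  Discrete.as (α := M.obj a) ((p.app ⟨a⟩).toFunctor.obj z)

variable {p : P ⟶ discretePseudofunctor M} {q : Q ⟶ discretePseudofunctor M}

theorem index_eq_of_hom {a : C} {z z' : P.obj ⟨a⟩} (g : z ⟶ z') : index p z = index p z' :=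
  Discrete.eq_of_hom (α := M.obj a) ((p.app ⟨a⟩).toFunctor.map g)

/-- A naturality cell of `p` is a morphism of a discrete category, hence an equality of elements. -/
theorem index_map {a b : C} (f : a ⟶ b) (z : P.obj ⟨a⟩) :
    index p ((P.map f.toLoc).toFunctor.obj z) = M.map f (index p z) :=
  Discrete.eq_of_hom (α := M.obj b) ((p.naturality f.toLoc).hom.toNatTrans.app z)

/-- A 1-cell of the slice over `M` preserves indices. -/
theorem index_app {α : P ⟶ Q} (h : α ≫ q = p) {a : C} (z : P.obj ⟨a⟩) :
    index q ((α.app ⟨a⟩).toFunctor.obj z) = index p z := by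
  subst h; rfl

/-- A transformation to `M` is determined by the indices it assigns to objects, since all its cells
lie in discrete categories. -/
theorem hom_discrete_ext {α β : P ⟶ discretePseudofunctor M}
    (h : ∀ {a : C} (z : P.obj ⟨a⟩), index α z = index β z) : α = β :=
  Pseudofunctor.StrongTrans.ext_of_app
    (fun a => Cat.ext (CategoryTheory.Functor.ext
      (fun z => Discrete.ext (α := M.obj a.as) (h z))
      (fun _ _ _ => (Discrete.instSubsingletonDiscreteHom (α := M.obj a.as) _ _).elim _ _)))
    (fun _ => discrete_hom₂_ext _ _)

/-- The fibre over `x` of the component of `p` at the object `a`. -/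
abbrev Fibre (p : P ⟶ discretePseudofunctor M) {a : C} (x : M.obj a) : Type w :=
  ObjectProperty.FullSubcategory (fun z : P.obj ⟨a⟩ => index p z = x)

theorem Fibre.eqToHom_hom {p : P ⟶ discretePseudofunctor M} {a : C} {x : M.obj a}
    {z z' : Fibre p x} (h : z = z') :
    (eqToHom h).hom = eqToHom (congrArg ObjectProperty.FullSubcategory.obj h) := by
  subst h; rfl

theorem Fibre.functor_ext {X : Type w} [Category.{w} X] {a : C} {x : M.obj a}
    {F G : X ⥤ Fibre p x}
    (h : F ⋙ ObjectProperty.ι _ = G ⋙ ObjectProperty.ι _) : F = G := by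
  refine CategoryTheory.Functor.ext (fun x => ?_) (fun x y k => ?_)
  · exact ObjectProperty.FullSubcategory.ext (Functor.congr_obj h x)
  · apply InducedCategory.Hom.ext
    have := Functor.congr_hom h k
    simp only [ObjectProperty.FullSubcategory.comp_hom, Fibre.eqToHom_hom]
    exact this

section

variable (p) {a b c d : C} {x : M.obj a} {y : M.obj b} {t : M.obj c} {s : M.obj d}

/-- The restriction to fibres of the value of `P` at a morphism. -/
@[simps! obj_obj map_hom]
def fibreMap (f : a ⟶ b) (hf : M.map f x = y) : Fibre p x ⥤ Fibre p y :=
  ObjectProperty.lift _ (ObjectProperty.ι _ ⋙ (P.map f.toLoc).toFunctor)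
    (fun z => (index_map f z.obj).trans (by rw [z.property, hf]))

/-- The restriction to fibres of a compositor of `P`. -/
@[simps!]
def fibreMapComp (f : a ⟶ b) (g : b ⟶ c) (hf : M.map f x = y) (hg : M.map g y = t)
    (hfg : M.map (f ≫ g) x = t) :
    fibreMap p (f ≫ g) hfg ≅ fibreMap p f hf ⋙ fibreMap p g hg :=
  NatIso.ofComponents
    (fun z => ObjectProperty.isoMk _
      ((Cat.Hom.toNatIso (P.mapComp f.toLoc g.toLoc)).app z.obj))
    (fun k => InducedCategory.Hom.ext
      ((P.mapComp f.toLoc g.toLoc).hom.toNatTrans.naturality k.hom))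

theorem fibreMapComp_assoc (f : a ⟶ b) (g : b ⟶ c) (h : c ⟶ d) (hf : M.map f x = y)
    (hg : M.map g y = t) (hh : M.map h t = s) (hfg : M.map (f ≫ g) x = t)
    (hgh : M.map (g ≫ h) y = s) (h₁ : M.map ((f ≫ g) ≫ h) x = s)
    (h₂ : M.map (f ≫ g ≫ h) x = s) (z : Fibre p x) :
    (fibreMapComp p (f ≫ g) h hfg hh h₁).hom.app z ≫
        (fibreMap p h hh).map ((fibreMapComp p f g hf hg hfg).hom.app z) =
      eqToHom (by simp only [Category.assoc]) ≫
        (fibreMapComp p f (g ≫ h) hf hgh h₂).hom.app z ≫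
          (fibreMapComp p g h hg hh hgh).hom.app ((fibreMap p f hf).obj z) := by
  apply InducedCategory.Hom.ext
  simp only [ObjectProperty.FullSubcategory.comp_hom, Fibre.eqToHom_hom]
  exact P.mapComp_assoc_app f.toLoc g.toLoc h.toLoc z.obj

variable {W : MorphismProperty C}

theorem fibreMapComp_eq (hP : IsPseudoFFunctor W P) (f : a ⟶ b) (g : b ⟶ c)
    (hf : M.map f x = y) (hg : M.map g y = t) (hfg : M.map (f ≫ g) x = t) (h : W f ∨ W g)
    (z : Fibre p x) :
    ∃ h, (fibreMapComp p f g hf hg hfg).hom.app z = eqToHom h := by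
  obtain ⟨h, e⟩ := hP.mapComp_app f g h z.obj
  refine ⟨ObjectProperty.FullSubcategory.ext h, InducedCategory.Hom.ext ?_⟩
  rw [Fibre.eqToHom_hom]
  exact e

theorem fibreMap_id (hP : IsPseudoFFunctor W P) (h : M.map (𝟙 a) x = x) :
    fibreMap p (𝟙 a) h = 𝟭 _ := Fibre.functor_ext (by
  have := (hP.mapId_eq ⟨a⟩).1
  change ObjectProperty.ι _ ⋙ (P.map (𝟙 _)).toFunctor = _
  rw [this]
  rfl)

end

variable {W : MorphismProperty C} [W.IsMultiplicative]

/-- The pseudofunctor of fibres of a pseudonatural transformation `p` with discrete codomain `M`,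
on the category of elements of `M`. -/
@[simps! obj map]
def fibre (hP : IsPseudoFFunctor W P) (p : P ⟶ discretePseudofunctor M) :
    LocallyDiscrete M.Elements ⥤ᵖ Cat.{w, w} :=
  Pseudofunctor.ofComponents (fun e => Cat.of (Fibre p e.2))
    (fun f => (fibreMap p f.1 f.2).toCatHom)
    (fun e => Cat.ext (fibreMap_id p hP (𝟙 e : e ⟶ e).2))
    (fun f g => Cat.Hom.isoMk (fibreMapComp p f.1 g.1 f.2 g.2 (f ≫ g).2))
    (fun f g h z => fibreMapComp_assoc p f.1 g.1 h.1 f.2 g.2 h.2 _ _ _ _ z)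
    (fun f z => (fibreMapComp_eq p hP (𝟙 _) f.1 _ f.2 _ (Or.inl (W.id_mem _)) z).2)
    (fun f z => (fibreMapComp_eq p hP f.1 (𝟙 _) f.2 _ _ (Or.inr (W.id_mem _)) z).2)

theorem isPseudoFFunctor_fibre (hP : IsPseudoFFunctor W P) (p : P ⟶ discretePseudofunctor M) :
    IsPseudoFFunctor (W.inverseImage (CategoryOfElements.π M)) (fibre hP p) :=
  .of_components (fun _ => ⟨_, rfl⟩) (fun f g h z => fibreMapComp_eq p hP f.1 g.1 f.2 g.2 _ h z)

/-! ### Restriction of transformations to fibres -/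

section

variable {α : P ⟶ Q} (h : α ≫ q = p) {a b c : C} {x : M.obj a} {y : M.obj b} {t : M.obj c}

/-- The restriction to fibres of a component of a transformation over `M`. -/
@[simps! obj_obj map_hom]
def fibreApp (x : M.obj a) : Fibre p x ⥤ Fibre q x :=
  ObjectProperty.lift _ (ObjectProperty.ι _ ⋙ (α.app ⟨a⟩).toFunctor)
    (fun z => (index_app h z.obj).trans z.property)

/-- The restriction to fibres of a naturality cell of a transformation over `M`. -/
@[simps!]
def fibreNaturality (f : a ⟶ b) (hf : M.map f x = y) :
    fibreMap p f hf ⋙ fibreApp h y ≅ fibreApp h x ⋙ fibreMap q f hf :=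
  NatIso.ofComponents
    (fun z => ObjectProperty.isoMk _ ((Cat.Hom.toNatIso (α.naturality f.toLoc)).app z.obj))
    (fun k => InducedCategory.Hom.ext
      ((α.naturality f.toLoc).hom.toNatTrans.naturality k.hom))

theorem fibreNaturality_comp (f : a ⟶ b) (g : b ⟶ c) (hf : M.map f x = y) (hg : M.map g y = t)
    (hfg : M.map (f ≫ g) x = t) (z : Fibre p x) :
    (fibreNaturality h (f ≫ g) hfg).hom.app z ≫
        (fibreMapComp q f g hf hg hfg).hom.app ((fibreApp h x).obj z) =
      (fibreApp h t).map ((fibreMapComp p f g hf hg hfg).hom.app z) ≫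
        (fibreNaturality h g hg).hom.app ((fibreMap p f hf).obj z) ≫
          (fibreMap q g hg).map ((fibreNaturality h f hf).hom.app z) :=
  InducedCategory.Hom.ext (α.naturality_comp_app f.toLoc g.toLoc z.obj)

omit [W.IsMultiplicative] in
theorem fibreNaturality_eq (hα : IsPseudoFTrans W α) (f : a ⟶ b) (hf : M.map f x = y) (h' : W f)
    (z : Fibre p x) : ∃ e, (fibreNaturality h f hf).hom.app z = eqToHom e := by
  obtain ⟨e, e'⟩ := naturality_app_of_isPseudoFTrans hα f h' z.obj
  refine ⟨ObjectProperty.FullSubcategory.ext e, InducedCategory.Hom.ext ?_⟩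
  rw [Fibre.eqToHom_hom]
  exact e'

end

/-- The restriction to fibres of a pseudo-`𝓕`-transformation over `M`. -/
@[simps! app]
def fibreTrans {hP : IsPseudoFFunctor W P} {hQ : IsPseudoFFunctor W Q} {α : P ⟶ Q}
    (hα : IsPseudoFTrans W α) (h : α ≫ q = p) : fibre hP p ⟶ fibre hQ q :=
  Pseudofunctor.StrongTrans.ofComponents
    (isPseudoFFunctor_fibre hP p).mapId_eq (isPseudoFFunctor_fibre hQ q).mapId_eq
    (fun e => (fibreApp h e.as.2).toCatHom)
    (fun f => Cat.Hom.isoMk (fibreNaturality h f.as.1 f.as.2))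
    (fun e z => fibreNaturality_eq (W := W) h hα (𝟙 e.as.1) _ (W.id_mem _) z)
    (fun f g z => fibreNaturality_comp h f.as.1 g.as.1 f.as.2 g.as.2 _ z)

end
end FSketch

/-! ### Transformations and modifications over `M` are determined by the fibres -/

namespace FSketch

section

variable {C : Type u} [Category.{v} C] {M : C ⥤ Type w} {P Q : LocallyDiscrete C ⥤ᵖ Cat.{w, w}}
  {p : P ⟶ discretePseudofunctor M} {q : Q ⟶ discretePseudofunctor M}
  {W : MorphismProperty C} [W.IsMultiplicative]
  {hP : IsPseudoFFunctor W P} {hQ : IsPseudoFFunctor W Q}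

theorem isPseudoFTrans_fibreTrans {α : P ⟶ Q} (hα : IsPseudoFTrans W α) (h : α ≫ q = p) :
    IsPseudoFTrans (W.inverseImage (CategoryOfElements.π M))
      (fibreTrans (hP := hP) (hQ := hQ) hα h) :=
  isPseudoFTrans_of_components (fibreTrans (hP := hP) (hQ := hQ) hα h)
    (fun f hf z => fibreNaturality_eq h hα f.1 f.2 hf z)

/-- The restriction to fibres of a modification between transformations over `M`. -/
def fibreHom {α β : P ⟶ Q} (hα : IsPseudoFTrans W α) (hβ : IsPseudoFTrans W β) (h : α ≫ q = p)
    (h' : β ≫ q = p) (Γ : α ⟶ β) :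
    fibreTrans (hP := hP) (hQ := hQ) hα h ⟶ fibreTrans (hP := hP) (hQ := hQ) hβ h' :=
  Pseudofunctor.StrongTrans.homOfComponents
    (fun e => NatTrans.toCatHom₂
      { app := fun z => ObjectProperty.homMk ((Γ.as.app ⟨e.as.1⟩).toNatTrans.app z.obj)
        naturality := fun _ _ k => InducedCategory.Hom.ext
          ((Γ.as.app ⟨e.as.1⟩).toNatTrans.naturality k.hom) })
    (fun f z => InducedCategory.Hom.ext
      (Pseudofunctor.StrongTrans.modification_naturality_app Γ f.as.1.toLoc z.obj))

/-- Each object of `P` lies in exactly one fibre, so a modification between transformations over `M`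
is the same as a modification between their restrictions to the fibres. -/
theorem fibreHom_bijective {α β : P ⟶ Q} (hα : IsPseudoFTrans W α) (hβ : IsPseudoFTrans W β)
    (h : α ≫ q = p) (h' : β ≫ q = p) :
    Function.Bijective (fibreHom (hP := hP) (hQ := hQ) hα hβ h h') := by
  refine ⟨fun Γ Θ e => Pseudofunctor.StrongTrans.hom_ext_of_components fun a z => ?_, fun Θ => ?_⟩
  · have := congrArg (fun Λ => Pseudofunctor.StrongTrans.Hom.as Λ) e
    have := congrArg (fun Λ => Pseudofunctor.StrongTrans.Modification.app Λ
      ⟨⟨a.as, index p z⟩⟩) this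
    exact congrArg InducedCategory.Hom.hom (congr_app (congrArg Cat.Hom₂.toNatTrans this) ⟨z, rfl⟩)
  · -- the component of the modification at an object of `P` is read off in the fibre of the object
    let t {a : C} {x : M.obj a} (z : Fibre p x) :
        (α.app ⟨a⟩).toFunctor.obj z.obj ⟶ (β.app ⟨a⟩).toFunctor.obj z.obj :=
      InducedCategory.Hom.hom ((Θ.as.app ⟨⟨a, x⟩⟩).toNatTrans.app z)
    have ht {a : C} {x : M.obj a} (z : Fibre p x) : t (x := index p z.obj) ⟨z.obj, rfl⟩ = t z := by
      obtain ⟨z, rfl⟩ := z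
      rfl
    have nat {a : C} {z z' : P.obj ⟨a⟩} (k : z ⟶ z') :
        (α.app ⟨a⟩).toFunctor.map k ≫ t (x := index p z') ⟨z', rfl⟩ =
          t (x := index p z) ⟨z, rfl⟩ ≫ (β.app ⟨a⟩).toFunctor.map k := by
      let z₁ : Fibre p (index p z) := ⟨z, rfl⟩
      let z₂ : Fibre p (index p z) := ⟨z', (index_eq_of_hom k).symm⟩
      let k' : z₁ ⟶ z₂ := ObjectProperty.homMk k
      rw [ht z₂]
      exact congrArg InducedCategory.Hom.hom
        ((Θ.as.app ⟨⟨a, index p z⟩⟩).toNatTrans.naturality k')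
    refine ⟨Pseudofunctor.StrongTrans.homOfComponents (fun a => ⟨
      { app := fun z => t (x := index p z) ⟨z, rfl⟩
        naturality := fun _ _ k => nat k }⟩) (fun {a b} f z => ?_), ?_⟩
    · let z₁ : Fibre p (index p z) := ⟨z, rfl⟩
      let z₂ : Fibre p (M.map f.as (index p z)) := (fibreMap p f.as rfl).obj z₁
      let f' : (⟨⟨a.as, index p z⟩⟩ : LocallyDiscrete M.Elements) ⟶
        ⟨⟨b.as, M.map f.as (index p z)⟩⟩ := ⟨⟨f.as, rfl⟩⟩
      change t (x := index p z₂.obj) ⟨z₂.obj, rfl⟩ ≫ _ = _ ≫ (Q.map f).toFunctor.map (t z₁)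
      rw [ht z₂]
      exact congrArg InducedCategory.Hom.hom
        (Pseudofunctor.StrongTrans.modification_naturality_app Θ f' z₁)
    · exact Pseudofunctor.StrongTrans.hom_ext_of_components fun e z =>
        InducedCategory.Hom.ext (ht (x := e.as.2) z)

/-- Each morphism of a value of `P` lies in a single fibre, the index being constant along
morphisms, so a transformation over `M` is determined by its restriction to the fibres. -/
theorem fibreTrans_injective {α β : P ⟶ Q} (hα : IsPseudoFTrans W α) (hβ : IsPseudoFTrans W β)
    (h : α ≫ q = p) (h' : β ≫ q = p)
    (e : fibreTrans (hP := hP) (hQ := hQ) hα h = fibreTrans (hP := hP) (hQ := hQ) hβ h') :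
    α = β := by
  have e₁ {a : C} (x : M.obj a) : fibreApp h x = fibreApp h' x :=
    congrArg (fun F => Cat.Hom.toFunctor (Pseudofunctor.StrongTrans.app F ⟨⟨a, x⟩⟩)) e
  refine Pseudofunctor.StrongTrans.ext_of_components
    (fun a => Functor.hext (fun z => ?_) (fun z z' k => ?_)) (fun {a b} f z => ?_)
  · exact congrArg ObjectProperty.FullSubcategory.obj
      (Functor.congr_obj (e₁ (index p z)) ⟨z, rfl⟩)
  · let z₁ : Fibre p (index p z) := ⟨z, rfl⟩
    let z₂ : Fibre p (index p z) := ⟨z', (index_eq_of_hom k).symm⟩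
    let k' : z₁ ⟶ z₂ := ObjectProperty.homMk k
    exact ObjectProperty.hom_heq_hom (Functor.congr_obj (e₁ _) z₁) (Functor.congr_obj (e₁ _) z₂)
      (Functor.map_heq_of_eq (e₁ _) k')
  · let f' : (⟨⟨a.as, index p z⟩⟩ : LocallyDiscrete M.Elements) ⟶
        ⟨⟨b.as, M.map f.as (index p z)⟩⟩ := ⟨⟨f.as, rfl⟩⟩
    let z₁ : Fibre p (index p z) := ⟨z, rfl⟩
    exact ObjectProperty.hom_heq_hom (Functor.congr_obj (e₁ _) ((fibreMap p f.as rfl).obj z₁))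
      (congrArg (fibreMap q f.as rfl).obj (Functor.congr_obj (e₁ _) z₁))
      (Pseudofunctor.StrongTrans.naturality_app_congr e f' z₁)

/-! ### Gluing transformations along fibres -/

section

variable (B : ∀ {a : C} (x : M.obj a), Fibre p x ⥤ Fibre q x)

/-- The fibre in which the value of the glued functor is computed can be replaced by any equal
one. -/
theorem glue_obj {a : C} {x : M.obj a} (z : Fibre p x) :
    ((B (index p z.obj)).obj ⟨z.obj, rfl⟩).obj = ((B x).obj z).obj := by
  obtain ⟨z, rfl⟩ := z
  rfl

theorem glue_map {a : C} {x x' : M.obj a} (h : x = x') {z z' : P.obj ⟨a⟩} (k : z ⟶ z')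
    (hz : index p z = x) (hz' : index p z' = x) :
    ((B x).map (ObjectProperty.homMk k : (⟨z, hz⟩ : Fibre p x) ⟶ ⟨z', hz'⟩)).hom ≍
      ((B x').map (ObjectProperty.homMk k :
        (⟨z, hz.trans h⟩ : Fibre p x') ⟶ ⟨z', hz'.trans h⟩)).hom := by
  subst h; rfl

/-- The functor obtained by gluing functors between the fibres. -/
def glueApp (a : C) : P.obj ⟨a⟩ ⥤ Q.obj ⟨a⟩ where
  obj z := ((B (index p z)).obj ⟨z, rfl⟩).obj
  map {z z'} k := ((B (index p z)).map (ObjectProperty.homMk k :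
      (⟨z, rfl⟩ : Fibre p (index p z)) ⟶ ⟨z', (index_eq_of_hom k).symm⟩)).hom ≫
    eqToHom (glue_obj B ⟨z', (index_eq_of_hom k).symm⟩).symm
  map_id z := by
    have := congrArg InducedCategory.Hom.hom ((B (index p z)).map_id ⟨z, rfl⟩)
    rw [eqToHom_refl, Category.comp_id]
    exact this
  map_comp {z z' z''} k k' := by
    have := congrArg InducedCategory.Hom.hom ((B (index p z)).map_comp
      (ObjectProperty.homMk k : (⟨z, rfl⟩ : Fibre p (index p z)) ⟶
        ⟨z', (index_eq_of_hom k).symm⟩)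
      (ObjectProperty.homMk k' : (⟨z', (index_eq_of_hom k).symm⟩ : Fibre p (index p z)) ⟶
        ⟨z'', (index_eq_of_hom (k ≫ k')).symm⟩))
    refine eq_of_heq ((comp_eqToHom_heq _ _).trans ((heq_of_eq this).trans ?_))
    exact heq_comp rfl (glue_obj B ⟨z', (index_eq_of_hom k).symm⟩).symm
      (glue_obj B ⟨z'', (index_eq_of_hom (k ≫ k')).symm⟩).symm (comp_eqToHom_heq _ _).symm
      ((glue_map B (index_eq_of_hom k) k' _ _).trans (comp_eqToHom_heq _ _).symm)

theorem glueApp_obj {a : C} {x : M.obj a} (z : Fibre p x) :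
    (glueApp B a).obj z.obj = ((B x).obj z).obj := glue_obj B z

theorem glueApp_map {a : C} {x : M.obj a} {z z' : Fibre p x} (k : z ⟶ z') :
    (glueApp B a).map k.hom ≍ ((B x).map k).hom := by
  obtain ⟨z, rfl⟩ := z
  exact comp_eqToHom_heq _ _

variable (N : ∀ {a b : C} {x : M.obj a} {y : M.obj b} (f : a ⟶ b) (hf : M.map f x = y),
  fibreMap p f hf ⋙ B y ≅ B x ⋙ fibreMap q f hf)

/-- The component at an object of a naturality cell of a glued transformation. -/
def glueCell {a b : C} (f : a ⟶ b) (z : P.obj ⟨a⟩) :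
    (glueApp B b).obj ((P.map f.toLoc).toFunctor.obj z) ≅
      (Q.map f.toLoc).toFunctor.obj ((glueApp B a).obj z) :=
  eqToIso (glueApp_obj B ((fibreMap p f rfl).obj ⟨z, rfl⟩)) ≪≫
    (ObjectProperty.ι _).mapIso ((N f rfl).app (⟨z, rfl⟩ : Fibre p (index p z)))

/-- A glued cell at an object of index `x` can be computed over any morphism of elements `x ⟶ y`
lying over `f`, not only over the one with codomain `M.map f x`. -/
theorem glueCell_hom {a b : C} {x : M.obj a} {y : M.obj b} (f : a ⟶ b) (hf : M.map f x = y)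
    (z : Fibre p x) : (glueCell B N f z.obj).hom ≍ ((N f hf).hom.app z).hom := by
  subst hf
  obtain ⟨z, rfl⟩ := z
  exact eqToHom_comp_heq ((N f rfl).hom.app (⟨z, rfl⟩ : Fibre p (index p z))).hom
    (glueApp_obj B ((fibreMap p f rfl).obj (⟨z, rfl⟩ : Fibre p (index p z))))

/-- A naturality cell of a glued transformation. -/
def glueNaturality {a b : C} (f : a ⟶ b) :
    (P.map f.toLoc).toFunctor ⋙ glueApp B b ≅ glueApp B a ⋙ (Q.map f.toLoc).toFunctor :=
  NatIso.ofComponents (glueCell B N f) (fun {z z'} k => by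
    let z₁ : Fibre p (index p z) := ⟨z, rfl⟩
    let z₂ : Fibre p (index p z) := ⟨z', (index_eq_of_hom k).symm⟩
    let k' : z₁ ⟶ z₂ := ObjectProperty.homMk k
    have e := congrArg InducedCategory.Hom.hom ((N f rfl).hom.naturality k')
    have h₁ := glueApp_obj B ((fibreMap p f rfl).obj z₁)
    have h₂ := glueApp_obj B ((fibreMap p f rfl).obj z₂)
    have h₃ := congrArg (Q.map f.toLoc).toFunctor.obj (glueApp_obj B z₂)
    exact eq_of_heq ((heq_comp h₁ h₂ h₃ (glueApp_map B ((fibreMap p f rfl).map k'))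
      (glueCell_hom B N f rfl z₂)).trans ((heq_of_eq e).trans
        (heq_comp h₁ rfl h₃ (glueCell_hom B N f rfl z₁)
          (Functor.map_heq_map _ rfl (glueApp_obj B z₂) (glueApp_map B k'))).symm)))

variable (N_eq : ∀ {a b : C} {x : M.obj a} {y : M.obj b} (f : a ⟶ b) (hf : M.map f x = y),
    W f → ∀ z, ∃ h, (N f hf).hom.app z = eqToHom h)
  (N_comp : ∀ {a b c : C} {x : M.obj a} {y : M.obj b} {t : M.obj c} (f : a ⟶ b) (g : b ⟶ c)
    (hf : M.map f x = y) (hg : M.map g y = t) (hfg : M.map (f ≫ g) x = t) (z : Fibre p x),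
    (N (f ≫ g) hfg).hom.app z ≫ (fibreMapComp q f g hf hg hfg).hom.app ((B x).obj z) =
      (B t).map ((fibreMapComp p f g hf hg hfg).hom.app z) ≫
        (N g hg).hom.app ((fibreMap p f hf).obj z) ≫
          (fibreMap q g hg).map ((N f hf).hom.app z))

omit [W.IsMultiplicative] in
include N_eq in
theorem glueCell_eq {a b : C} (f : a ⟶ b) (hf : W f) (z : P.obj ⟨a⟩) :
    ∃ h, (glueCell B N f z).hom = eqToHom h := by
  let z₁ : Fibre p (index p z) := ⟨z, rfl⟩
  obtain ⟨h, e⟩ := N_eq f rfl hf z₁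
  exact exists_eq_eqToHom_of_heq (glueApp_obj B ((fibreMap p f rfl).obj z₁)) rfl
    (glueCell_hom B N f rfl z₁)
    ⟨congrArg ObjectProperty.FullSubcategory.obj h, by rw [e, Fibre.eqToHom_hom]; rfl⟩

include N_comp in
theorem glueCell_comp {a b c : C} (f : a ⟶ b) (g : b ⟶ c) (z : P.obj ⟨a⟩) :
    (glueCell B N (f ≫ g) z).hom ≫
        (Q.mapComp f.toLoc g.toLoc).hom.toNatTrans.app ((glueApp B a).obj z) =
      (glueApp B c).map ((P.mapComp f.toLoc g.toLoc).hom.toNatTrans.app z) ≫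
        (glueCell B N g ((P.map f.toLoc).toFunctor.obj z)).hom ≫
          (Q.map g.toLoc).toFunctor.map (glueCell B N f z).hom := by
  let z₁ : Fibre p (index p z) := ⟨z, rfl⟩
  let z₂ := (fibreMap p f rfl).obj z₁
  have hfg : M.map (f ≫ g) (index p z) = M.map g (M.map f (index p z)) := by simp
  have e := congrArg InducedCategory.Hom.hom (N_comp f g rfl rfl hfg z₁)
  have h₀ := glueApp_obj B ((fibreMap p (f ≫ g) hfg).obj z₁)
  have h₁ := glueApp_obj B ((fibreMap p g rfl).obj z₂)
  have h₂ := congrArg (Q.map g.toLoc).toFunctor.obj (glueApp_obj B z₂)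
  exact eq_of_heq ((heq_comp h₀ rfl rfl (glueCell_hom B N (f ≫ g) hfg z₁) .rfl).trans
    ((heq_of_eq e).trans (heq_comp h₀ h₁ rfl
      (glueApp_map B ((fibreMapComp p f g rfl rfl hfg).hom.app z₁))
      (heq_comp h₁ h₂ rfl (glueCell_hom B N g rfl z₂)
        (Functor.map_heq_map _ (glueApp_obj B z₂) rfl (glueCell_hom B N f rfl z₁)))).symm))

end

/-- A pseudo-`𝓕`-transformation between the pseudofunctors of fibres is the restriction of a
transformation over `M`, obtained by gluing its components along the fibres. -/
theorem exists_fibreTrans_eq {β : fibre hP p ⟶ fibre hQ q}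
    (hβ : IsPseudoFTrans (W.inverseImage (CategoryOfElements.π M)) β) :
    ∃ (α : P ⟶ Q) (hα : IsPseudoFTrans W α) (h : α ≫ q = p),
      fibreTrans (hP := hP) (hQ := hQ) hα h = β := by
  let B {a : C} (x : M.obj a) : Fibre p x ⥤ Fibre q x := (β.app ⟨⟨a, x⟩⟩).toFunctor
  let N {a b : C} {x : M.obj a} {y : M.obj b} (f : a ⟶ b) (hf : M.map f x = y) :
      fibreMap p f hf ⋙ B y ≅ B x ⋙ fibreMap q f hf :=
    Cat.Hom.toNatIso (β.naturality
      (show (⟨⟨a, x⟩⟩ : LocallyDiscrete M.Elements) ⟶ ⟨⟨b, y⟩⟩ from ⟨⟨f, hf⟩⟩))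
  have N_eq {a b : C} {x : M.obj a} {y : M.obj b} (f : a ⟶ b) (hf : M.map f x = y) (h : W f)
      (z : Fibre p x) : ∃ h, (N f hf).hom.app z = eqToHom h :=
    naturality_app_of_isPseudoFTrans hβ (a := ⟨a, x⟩) (b := ⟨b, y⟩) ⟨f, hf⟩ h z
  let α : P ⟶ Q := Pseudofunctor.StrongTrans.ofComponents hP.mapId_eq hQ.mapId_eq
    (fun a => ⟨glueApp B a.as⟩)
    (fun f => Cat.Hom.isoMk (glueNaturality B N f.as))
    (fun a z => glueCell_eq B N N_eq (𝟙 a.as) (W.id_mem _) z)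
    (fun f g z => glueCell_comp B N (fun {a b c x y t} f g hf hg _ z =>
      Pseudofunctor.StrongTrans.naturality_comp_app β
        (show (⟨⟨a, x⟩⟩ : LocallyDiscrete M.Elements) ⟶ ⟨⟨b, y⟩⟩ from ⟨⟨f, hf⟩⟩)
        (show (⟨⟨b, y⟩⟩ : LocallyDiscrete M.Elements) ⟶ ⟨⟨c, t⟩⟩ from ⟨⟨g, hg⟩⟩) z) f.as g.as z)
  refine ⟨α, isPseudoFTrans_of_components α (fun f hf z => glueCell_eq B N N_eq f hf z),
    hom_discrete_ext (fun {a} z => ((B (index p z)).obj ⟨z, rfl⟩).property),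
    Pseudofunctor.StrongTrans.ext_of_components (fun e => ?_) (fun {e e'} f z => ?_)⟩
  · exact Functor.hext
      (fun z => ObjectProperty.FullSubcategory.ext (glueApp_obj B (x := e.as.2) z))
      (fun _ _ k => ObjectProperty.heq_of_hom_heq_hom
        (ObjectProperty.FullSubcategory.ext (glueApp_obj B (x := e.as.2) _))
        (ObjectProperty.FullSubcategory.ext (glueApp_obj B (x := e.as.2) _)) (glueApp_map B k))
  · exact ObjectProperty.heq_of_hom_heq_hom
      (ObjectProperty.FullSubcategory.ext
        (glueApp_obj B ((fibreMap p f.as.1 f.as.2).obj z)))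
      (ObjectProperty.FullSubcategory.ext
        (congrArg (Q.map f.as.1.toLoc).toFunctor.obj (glueApp_obj B (x := e.as.2) z)))
      (glueCell_hom B N f.as.1 f.as.2 z)

end

end FSketch

/-! ### Limit cones in `Cat` -/

section

variable {J : Type u₁} [Category.{v₁} J] {k : Cat.{w, w}} (T : J ⥤ Under k)

/-- The description of strict 2-limit cones in `Cat` by objects and morphisms: a compatible family
of objects (of morphisms) of the diagram comes from a unique object (morphism) of the vertex. -/
structure IsCatLimit : Prop where
  obj : ∀ t : ∀ j, ((T.obj j).right : Cat.{w, w}),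
    (∀ {i j : J} (f : i ⟶ j), (coneTransition T f).toFunctor.obj (t i) = t j) →
    ∃! z : k, ∀ j, (coneLeg T j).toFunctor.obj z = t j
  map : ∀ (z z' : k) (φ : ∀ j, (coneLeg T j).toFunctor.obj z ⟶ (coneLeg T j).toFunctor.obj z'),
    (∀ {i j : J} (f : i ⟶ j), (coneTransition T f).toFunctor.map (φ i) ≍ φ j) →
    ∃! g : z ⟶ z', ∀ j, (coneLeg T j).toFunctor.map g = φ j

variable {T}

theorem coneTransition_obj {i j : J} (f : i ⟶ j) (z : k) :
    (coneTransition T f).toFunctor.obj ((coneLeg T i).toFunctor.obj z) =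
      (coneLeg T j).toFunctor.obj z :=
  Functor.congr_obj (congrArg Cat.Hom.toFunctor (coneLeg_transition T f)) z

theorem coneTransition_map {i j : J} (f : i ⟶ j) {z z' : k} (g : z ⟶ z') :
    (coneTransition T f).toFunctor.map ((coneLeg T i).toFunctor.map g) ≍
      (coneLeg T j).toFunctor.map g :=
  Functor.map_heq_of_eq (congrArg Cat.Hom.toFunctor (coneLeg_transition T f)) g

theorem IsCatLimit.obj_ext (hT : IsCatLimit T) {z z' : k}
    (h : ∀ j, (coneLeg T j).toFunctor.obj z = (coneLeg T j).toFunctor.obj z') : z = z' :=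
  (hT.obj _ (fun f => coneTransition_obj f z')).unique h (fun _ => rfl)

theorem IsCatLimit.map_ext (hT : IsCatLimit T) {z z' : k} {g g' : z ⟶ z'}
    (h : ∀ j, (coneLeg T j).toFunctor.map g = (coneLeg T j).toFunctor.map g') : g = g' :=
  (hT.map z z' _ (fun f => coneTransition_map f g')).unique h (fun _ => rfl)

/-- The functor from the point to a category, choosing an object. -/
abbrev pointHom {X : Cat.{w, w}} (z : X) : Cat.of (Discrete PUnit.{w + 1}) ⟶ X :=
  ⟨Functor.fromPUnit z⟩

theorem point_hom_ext {X : Cat.{w, w}} {F G : Cat.of (Discrete PUnit.{w + 1}) ⟶ X}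
    (h : F.toFunctor.obj ⟨⟨⟩⟩ = G.toFunctor.obj ⟨⟨⟩⟩) : F = G := by
  refine Cat.ext (Functor.hext (fun _ => h) ?_)
  rintro ⟨⟨⟩⟩ ⟨⟨⟩⟩ f
  obtain rfl : f = 𝟙 _ := Subsingleton.elim (α := (⟨⟨⟩⟩ : Discrete PUnit.{w + 1}) ⟶ ⟨⟨⟩⟩) _ _
  exact (heq_of_eq (F.toFunctor.map_id _)).trans
    (HEq.trans (by rw [h]) (heq_of_eq (G.toFunctor.map_id _)).symm)

/-- Compatibility of a family of 2-cells with the transitions of a cone in `Cat`, in terms of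
components. -/
theorem whiskerRight_coneTransition_iff {X : Cat.{w, w}} {l m : X ⟶ k}
    (θ : ∀ j : J, l ≫ coneLeg T j ⟶ m ≫ coneLeg T j) {i j : J} (f : i ⟶ j) :
    (θ i ▷ coneTransition T f ≫ eqToHom (comp_coneLeg_transition T f m) =
        eqToHom (comp_coneLeg_transition T f l) ≫ θ j) ↔
      ∀ z : X, (coneTransition T f).toFunctor.map ((θ i).toNatTrans.app z) ≍
        (θ j).toNatTrans.app z := by
  have e (z : X) : (θ i ▷ coneTransition T f ≫
      eqToHom (comp_coneLeg_transition T f m)).toNatTrans.app z ≍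
        (coneTransition T f).toFunctor.map ((θ i).toNatTrans.app z) := by
    simp only [Cat.Hom.toNatTrans_comp, NatTrans.comp_app, Cat.whiskerRight_app, Cat.eqToHom_app]
    exact comp_eqToHom_heq _ _
  have e' (z : X) : (eqToHom (comp_coneLeg_transition T f l) ≫ θ j).toNatTrans.app z ≍
      (θ j).toNatTrans.app z := by
    simp only [Cat.Hom.toNatTrans_comp, NatTrans.comp_app, Cat.eqToHom_app]
    exact eqToHom_comp_heq _ _
  refine ⟨fun h z => (e z).symm.trans (HEq.trans (by rw [h]) (e' z)), fun h => ?_⟩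
  exact Cat.Hom₂.ext <| NatTrans.ext <| funext fun z =>
    eq_of_heq ((e z).trans ((h z).trans (e' z).symm))

/-- The universal property of a 2-limit cone is tested on cones whose vertex is the point. -/
theorem IsTwoLimitCone.isCatLimit (hT : IsTwoLimitCone T) : IsCatLimit T where
  obj t ht := by
    obtain ⟨⟨L⟩, -⟩ := hT
    let s : Limits.Cone (T ⋙ Under.forget k) :=
      { pt := Cat.of (Discrete PUnit.{w + 1})
        π :=
          { app := fun j => pointHom (t j)
            naturality := fun i j f => point_hom_ext (ht f).symm } }
    refine ⟨(L.lift s).toFunctor.obj ⟨⟨⟩⟩, fun j => ?_, fun z hz => ?_⟩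
    · exact Functor.congr_obj (congrArg Cat.Hom.toFunctor (L.fac s j)) ⟨⟨⟩⟩
    · exact Functor.congr_obj (congrArg Cat.Hom.toFunctor
        (L.uniq s (pointHom z) (fun j => point_hom_ext (hz j)))) ⟨⟨⟩⟩
  map z z' φ hφ := by
    let θ (j : J) : pointHom z ≫ coneLeg T j ⟶ pointHom z' ≫ coneLeg T j :=
      ⟨Discrete.natTrans (fun _ => φ j)⟩
    have key := hT.2 (Cat.of (Discrete PUnit.{w + 1})) (pointHom z) (pointHom z') θ
      (fun f => (whiskerRight_coneTransition_iff θ f).2 fun _ => hφ f)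
    obtain ⟨η, hη, hu⟩ := key
    refine ⟨η.toNatTrans.app ⟨⟨⟩⟩, fun j => ?_, fun g hg => ?_⟩
    · exact congr_app (congrArg Cat.Hom₂.toNatTrans (hη j)) ⟨⟨⟩⟩
    · have := hu ⟨Discrete.natTrans (fun _ => g)⟩ (fun j =>
        Cat.Hom₂.ext <| NatTrans.ext <| funext fun x => by
          obtain ⟨⟨⟩⟩ := x
          exact hg j)
      exact congr_app (congrArg Cat.Hom₂.toNatTrans this) ⟨⟨⟩⟩

theorem IsCatLimit.exists_lift (hT : IsCatLimit T) {X : Cat.{w, w}}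
    (s : ∀ j, X ⟶ (T.obj j).right)
    (hs : ∀ {i j : J} (f : i ⟶ j), s i ≫ coneTransition T f = s j) :
    ∃ l : X ⟶ k, ∀ j, l ≫ coneLeg T j = s j := by
  have w {i j : J} (f : i ⟶ j) :
      (s i).toFunctor ⋙ (coneTransition T f).toFunctor = (s j).toFunctor :=
    congrArg Cat.Hom.toFunctor (hs f)
  have ex (z : X) := (hT.obj (fun j => (s j).toFunctor.obj z)
    (fun f => Functor.congr_obj (w f) z)).exists
  choose g hg using ex
  have exm {z z' : X} (f : z ⟶ z') := (hT.map (g z) (g z')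
    (fun j => eqToHom (hg z j) ≫ (s j).toFunctor.map f ≫ eqToHom (hg z' j).symm)
    (fun {i j} a => by
      refine HEq.trans ?_ ((eqToHom_comp_heq _ _).trans (comp_eqToHom_heq _ _)).symm
      refine HEq.trans ?_ (Functor.map_heq_of_eq (w a) f)
      exact Functor.map_heq_map _ (hg z i) (hg z' i)
        ((eqToHom_comp_heq _ _).trans (comp_eqToHom_heq _ _)))).exists
  choose m hm using @exm
  let l : X ⥤ k :=
    { obj := g
      map := m
      map_id := fun z => hT.map_ext fun j => by
        rw [hm, CategoryTheory.Functor.map_id, CategoryTheory.Functor.map_id]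
        simp
      map_comp := fun f f' => hT.map_ext fun j => by
        rw [hm, Functor.map_comp, Functor.map_comp, hm, hm]
        simp }
  refine ⟨⟨l⟩, fun j => Cat.ext (Functor.hext (fun z => hg z j) fun z z' f => ?_)⟩
  exact (heq_of_eq (hm f j)).trans ((eqToHom_comp_heq _ _).trans (comp_eqToHom_heq _ _))

theorem IsCatLimit.hom_ext (hT : IsCatLimit T) {X : Cat.{w, w}} {l m : X ⟶ k}
    (h : ∀ j, l ≫ coneLeg T j = m ≫ coneLeg T j) : l = m := by
  have hobj (z : X) : l.toFunctor.obj z = m.toFunctor.obj z := hT.obj_ext fun j =>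
    Functor.congr_obj (congrArg Cat.Hom.toFunctor (h j)) z
  refine Cat.ext (CategoryTheory.Functor.ext hobj fun z z' f => hT.map_ext fun j => ?_)
  rw [Functor.map_comp, Functor.map_comp, eqToHom_map, eqToHom_map]
  exact Functor.congr_hom (congrArg Cat.Hom.toFunctor (h j)) f

theorem IsCatLimit.isTwoLimitCone (hT : IsCatLimit T) : IsTwoLimitCone T := by
  refine ⟨⟨?_⟩, fun X l m θ hθ => ?_⟩
  · have ex (s : Limits.Cone (T ⋙ Under.forget k)) :=
      hT.exists_lift (X := s.pt) (fun j => s.π.app j) (fun f => s.w f)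
    choose l hl using ex
    exact
      { lift := l
        fac := hl
        uniq := fun s m hm => hT.hom_ext fun j => (hm j).trans (hl s j).symm }
  · have ex (z : X) := hT.map (l.toFunctor.obj z) (m.toFunctor.obj z)
      (fun j => (θ j).toNatTrans.app z) (fun f => (whiskerRight_coneTransition_iff θ f).1 (hθ f) z)
    choose η hη hu using ex
    refine ⟨⟨⟨η, fun z z' f => hT.map_ext fun j => ?_⟩⟩, fun j => ?_, fun ζ hζ => ?_⟩
    · rw [Functor.map_comp, Functor.map_comp, hη, hη]
      exact (θ j).toNatTrans.naturality f
    · exact Cat.Hom₂.ext <| NatTrans.ext <| funext fun z => hη z j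
    · refine Cat.Hom₂.ext <| NatTrans.ext <| funext fun z => hu z _ fun j => ?_
      exact congr_app (congrArg Cat.Hom₂.toNatTrans (hζ j)) z

/-- An embedding of cones in `Cat`: compatible functors between the vertices and the diagrams,
which are fully faithful and injective on objects. -/
structure ConeEmbedding {k' : Cat.{w, w}} (T' : J ⥤ Under k') (T : J ⥤ Under k) where
  vertex : k' ⟶ k
  leg (j : J) : ((T'.obj j).right : Cat.{w, w}) ⟶ (T.obj j).right
  vertex_leg (j : J) : vertex ≫ coneLeg T j = coneLeg T' j ≫ leg j
  leg_transition {i j : J} (f : i ⟶ j) :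
    leg i ≫ coneTransition T f = coneTransition T' f ≫ leg j
  vertexFullyFaithful : vertex.toFunctor.FullyFaithful
  legFullyFaithful (j : J) : (leg j).toFunctor.FullyFaithful
  vertex_injective : Function.Injective vertex.toFunctor.obj
  leg_injective (j : J) : Function.Injective (leg j).toFunctor.obj

namespace ConeEmbedding

variable {k' : Cat.{w, w}} {T' : J ⥤ Under k'} (E : ConeEmbedding T' T)

theorem vertex_leg_obj (j : J) (z : k') :
    (coneLeg T j).toFunctor.obj (E.vertex.toFunctor.obj z) =
      (E.leg j).toFunctor.obj ((coneLeg T' j).toFunctor.obj z) :=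
  Functor.congr_obj (congrArg Cat.Hom.toFunctor (E.vertex_leg j)) z

theorem vertex_leg_map (j : J) {z z' : k'} (g : z ⟶ z') :
    (coneLeg T j).toFunctor.map (E.vertex.toFunctor.map g) ≍
      (E.leg j).toFunctor.map ((coneLeg T' j).toFunctor.map g) :=
  Functor.map_heq_of_eq (congrArg Cat.Hom.toFunctor (E.vertex_leg j)) g

theorem leg_transition_obj {i j : J} (f : i ⟶ j) (z : ((T'.obj i).right : Cat.{w, w})) :
    (coneTransition T f).toFunctor.obj ((E.leg i).toFunctor.obj z) =
      (E.leg j).toFunctor.obj ((coneTransition T' f).toFunctor.obj z) :=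
  Functor.congr_obj (congrArg Cat.Hom.toFunctor (E.leg_transition f)) z

theorem leg_transition_map {i j : J} (f : i ⟶ j) {z z' : ((T'.obj i).right : Cat.{w, w})}
    (g : z ⟶ z') :
    (coneTransition T f).toFunctor.map ((E.leg i).toFunctor.map g) ≍
      (E.leg j).toFunctor.map ((coneTransition T' f).toFunctor.map g) :=
  Functor.map_heq_of_eq (congrArg Cat.Hom.toFunctor (E.leg_transition f)) g

theorem leg_map_injective_heq (j : J) {a b a' b' : ((T'.obj j).right : Cat.{w, w})} {g : a ⟶ b}
    {g' : a' ⟶ b'} (ha : a = a') (hb : b = b')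
    (h : (E.leg j).toFunctor.map g ≍ (E.leg j).toFunctor.map g') : g ≍ g' := by
  subst ha hb
  exact heq_of_eq ((E.legFullyFaithful j).map_injective (eq_of_heq h))

/-- Morphisms of the vertices of embedded cones determine and are determined by the same families,
as the embedding is fully faithful. -/
theorem existsUnique_map_iff (z z' : k')
    (φ : ∀ j, (coneLeg T' j).toFunctor.obj z ⟶ (coneLeg T' j).toFunctor.obj z')
    (ψ : ∀ j, (coneLeg T j).toFunctor.obj (E.vertex.toFunctor.obj z) ⟶
      (coneLeg T j).toFunctor.obj (E.vertex.toFunctor.obj z'))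
    (h : ∀ j, (E.leg j).toFunctor.map (φ j) ≍ ψ j) :
    (∃! g : z ⟶ z', ∀ j, (coneLeg T' j).toFunctor.map g = φ j) ↔
      ∃! g : E.vertex.toFunctor.obj z ⟶ E.vertex.toFunctor.obj z',
        ∀ j, (coneLeg T j).toFunctor.map g = ψ j := by
  have key (g : z ⟶ z') (j : J) : (coneLeg T' j).toFunctor.map g = φ j ↔
      (coneLeg T j).toFunctor.map (E.vertex.toFunctor.map g) = ψ j :=
    ⟨fun e => eq_of_heq ((E.vertex_leg_map j g).trans (by rw [e]; exact h j)),
      fun e => (E.legFullyFaithful j).map_injective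
        (eq_of_heq ((E.vertex_leg_map j g).symm.trans (by rw [e]; exact (h j).symm)))⟩
  refine ((E.vertexFullyFaithful.homEquiv (X := z) (Y := z')).existsUnique_congr ?_)
  exact fun {g} => forall_congr' (key g)

/-- An embedded cone is a limit cone if the ambient one is, provided that an object of the ambient
vertex belongs to the embedded vertex as soon as its projections belong to the embedded diagram. -/
theorem isCatLimit_of_isCatLimit (hT : IsCatLimit T)
    (hE : ∀ z : k, (∀ j, ∃ t, (E.leg j).toFunctor.obj t = (coneLeg T j).toFunctor.obj z) →
      ∃ z', E.vertex.toFunctor.obj z' = z) : IsCatLimit T' where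
  obj t ht := by
    obtain ⟨z, hz, -⟩ := hT.obj (fun j => (E.leg j).toFunctor.obj (t j)) (fun {i j} f => by
      rw [E.leg_transition_obj, ht])
    obtain ⟨z, rfl⟩ := hE z (fun j => ⟨t j, (hz j).symm⟩)
    refine ⟨z, fun j => E.leg_injective j ?_, fun z' hz' => E.vertex_injective
      (hT.obj_ext fun j => ?_)⟩
    · rw [← E.vertex_leg_obj, hz]
    · rw [hz, E.vertex_leg_obj, hz']
  map z z' φ hφ := by
    let ψ (j : J) : (coneLeg T j).toFunctor.obj (E.vertex.toFunctor.obj z) ⟶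
        (coneLeg T j).toFunctor.obj (E.vertex.toFunctor.obj z') :=
      eqToHom (E.vertex_leg_obj j z) ≫ (E.leg j).toFunctor.map (φ j) ≫
        eqToHom (E.vertex_leg_obj j z').symm
    have hψ (j : J) : (E.leg j).toFunctor.map (φ j) ≍ ψ j :=
      ((eqToHom_comp_heq _ _).trans (comp_eqToHom_heq _ _)).symm
    rw [E.existsUnique_map_iff z z' φ ψ hψ]
    refine hT.map _ _ ψ fun {i j} f => HEq.trans ?_ (hψ j)
    refine (Functor.map_heq_map _ (E.vertex_leg_obj i z) (E.vertex_leg_obj i z')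
      (hψ i).symm).trans ((E.leg_transition_map f _).trans ?_)
    exact Functor.map_heq_map _ (coneTransition_obj f z) (coneTransition_obj f z') (hφ f)

end ConeEmbedding

/-- A cone in `Cat` is a limit cone if it is covered by embedded limit cones: each compatible family
of objects lies in one of them, and so do any two objects of the vertex whose projections are
connected by morphisms. The second condition also yields the uniqueness of an object with
given projections, the connecting morphisms then being identities. -/
theorem isCatLimit_of_cover {X : Type*} {k' : X → Cat.{w, w}} {T' : ∀ x, J ⥤ Under (k' x)}
    (E : ∀ x, ConeEmbedding (T' x) T) (hT' : ∀ x, IsCatLimit (T' x))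
    (hobj : ∀ t : ∀ j, ((T.obj j).right : Cat.{w, w}),
      (∀ {i j : J} (f : i ⟶ j), (coneTransition T f).toFunctor.obj (t i) = t j) →
      ∃ x, ∀ j, ∃ t', ((E x).leg j).toFunctor.obj t' = t j)
    (hmap : ∀ z z' : k,
      (∀ j, Nonempty ((coneLeg T j).toFunctor.obj z ⟶ (coneLeg T j).toFunctor.obj z')) →
      ∃ x y y', (E x).vertex.toFunctor.obj y = z ∧ (E x).vertex.toFunctor.obj y' = z') :
    IsCatLimit T where
  obj t ht := by
    obtain ⟨x, hx⟩ := hobj t ht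
    choose t' ht' using hx
    obtain rfl : (fun j => ((E x).leg j).toFunctor.obj (t' j)) = t := funext ht'
    obtain ⟨z, hz, hu⟩ := (hT' x).obj t' (fun {i j} f => (E x).leg_injective j (by
      rw [← (E x).leg_transition_obj]; exact ht f))
    refine ⟨(E x).vertex.toFunctor.obj z, fun j => ?_, fun z' hz' => ?_⟩
    · rw [(E x).vertex_leg_obj, hz]
    · have e (j : J) : (coneLeg T j).toFunctor.obj ((E x).vertex.toFunctor.obj z) =
          (coneLeg T j).toFunctor.obj z' := by rw [(E x).vertex_leg_obj, hz, hz']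
      obtain ⟨y, y₁, y₂, h₁, rfl⟩ := hmap _ z' (fun j => ⟨eqToHom (e j)⟩)
      rw [← h₁] at e ⊢
      congr 1
      refine (hT' y).obj_ext fun j => ((E y).leg_injective j ?_)
      rw [← (E y).vertex_leg_obj, ← (E y).vertex_leg_obj, e]
  map z z' ψ hψ := by
    obtain ⟨x, z, z', rfl, rfl⟩ := hmap z z' (fun j => ⟨ψ j⟩)
    let φ (j : J) : (coneLeg (T' x) j).toFunctor.obj z ⟶ (coneLeg (T' x) j).toFunctor.obj z' :=
      ((E x).legFullyFaithful j).preimage (eqToHom ((E x).vertex_leg_obj j z).symm ≫ ψ j ≫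
        eqToHom ((E x).vertex_leg_obj j z'))
    have hφ (j : J) : ((E x).leg j).toFunctor.map (φ j) ≍ ψ j := by
      rw [((E x).legFullyFaithful j).map_preimage]
      exact (eqToHom_comp_heq _ _).trans (comp_eqToHom_heq _ _)
    rw [← (E x).existsUnique_map_iff z z' φ ψ hφ]
    refine (hT' x).map z z' φ fun {i j} f => (E x).leg_map_injective_heq j
      (coneTransition_obj f z) (coneTransition_obj f z') ?_
    refine (((E x).leg_transition_map f _).symm.trans ?_).trans (hφ j).symm
    exact (Functor.map_heq_map _ ((E x).vertex_leg_obj i z).symm ((E x).vertex_leg_obj i z').symm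
      (hφ i)).trans (hψ f)

end

/-! ### Models over a discrete model and models of the category of elements -/

namespace FSketch

section

variable {C : Type u} [Category.{v} C] {A : FSketch.{uJ, vJ, wJ} C} {M : C ⥤ Type w}

section

variable {J : Type uJ} [Bicategory.{wJ, vJ} J] [Strict J] {a : C}

/-- A marked cone is jointly injective after applying a set-valued model. -/
theorem IsSetModel.eq_of_forall (hM : A.IsSetModel M) {S : FCone A.inert J a}
    (hS : A.marked J a S) {x y : M.obj a}
    (h : ∀ j, M.map (S.functor.obj j).hom.hom x = M.map (S.functor.obj j).hom.hom y) : x = y := by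
  obtain ⟨hL⟩ := hM J a S hS
  have := hL.hom_ext (f := ↾fun _ : PUnit.{w + 1} => x) (f' := ↾fun _ => y) (fun j => by
    ext; exact h j)
  exact ConcreteCategory.congr_hom this PUnit.unit

/-- A compatible family of elements over a marked cone comes from an element over its vertex. -/
theorem IsSetModel.exists_of_compatible (hM : A.IsSetModel M) {S : FCone A.inert J a}
    (hS : A.marked J a S) (m : ∀ j, M.obj (S.functor.obj j).right.obj)
    (hm : ∀ {i j : J} (f : i ⟶ j), M.map (S.functor.map f).right.hom (m i) = m j) :
    ∃ x : M.obj a, ∀ j, M.map (S.functor.obj j).hom.hom x = m j := by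
  obtain ⟨hL⟩ := hM J a S hS
  let c : Limits.Cone ((S.functor ⋙ Under.post
      (wideSubcategoryInclusion A.inert ⋙ M)) ⋙ Under.forget _) :=
    { pt := PUnit.{w + 1}
      π :=
        { app := fun j => ↾fun _ => m j
          naturality := fun i j f => by
            ext z
            exact (hm f).symm } }
  exact ⟨hL.lift c PUnit.unit, fun j => ConcreteCategory.congr_hom (hL.fac c j) PUnit.unit⟩

theorem map_hom_map_right {W : MorphismProperty C} [W.IsMultiplicative] (S : FCone W J a)
    (x : M.obj a) {i j : J} (f : i ⟶ j) :
    M.map (S.functor.map f).right.hom (M.map (S.functor.obj i).hom.hom x) =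
      M.map (S.functor.obj j).hom.hom x :=
  (M.map_comp_apply _ _ x).symm.trans (congrArg (fun k => M.map k x)
    (congrArg (fun k => InducedWideCategory.Hom.hom k) (Under.w (S.functor.map f))))

/-- The lift of a cone to the category of elements, with vertex a given element. -/
def liftCone {W : MorphismProperty C} [W.IsMultiplicative] (S : FCone W J a) (x : M.obj a) :
    FCone (W.inverseImage (CategoryOfElements.π M)) J (M.elementsMk a x) where
  functor :=
    { obj := fun j => Under.mk (X := WideSubcategory.mk (M.elementsMk a x))
        (Y := WideSubcategory.mk (M.elementsMk (S.functor.obj j).right.obj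
          (M.map (S.functor.obj j).hom.hom x)))
        ⟨⟨(S.functor.obj j).hom.hom, rfl⟩, (S.functor.obj j).hom.property⟩
      map := fun f => Under.homMk ⟨⟨(S.functor.map f).right.hom, map_hom_map_right S x f⟩,
          (S.functor.map f).right.property⟩
        (WideSubcategory.hom_ext _ (Subtype.ext
          (congrArg (fun k => InducedWideCategory.Hom.hom k) (Under.w (S.functor.map f)))))
      map_id := fun j => Under.UnderMorphism.ext (WideSubcategory.hom_ext _ (Subtype.ext
        (congrArg (fun k => InducedWideCategory.Hom.hom (CommaMorphism.right k))
          (S.functor.map_id j))))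
      map_comp := fun f g => Under.UnderMorphism.ext (WideSubcategory.hom_ext _ (Subtype.ext
        (congrArg (fun k => InducedWideCategory.Hom.hom (CommaMorphism.right k))
          (S.functor.map_comp f g)))) }
  map_eq_of_hom₂ η := Under.UnderMorphism.ext (WideSubcategory.hom_ext _ (Subtype.ext
    (congrArg (fun k => InducedWideCategory.Hom.hom (CommaMorphism.right k))
      (S.map_eq_of_hom₂ η))))

end

variable {P : LocallyDiscrete C ⥤ᵖ Cat.{w, w}} (p : P ⟶ discretePseudofunctor M)
  (Q : LocallyDiscrete M.Elements ⥤ᵖ Cat.{w, w})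

/-- An identification of the values of `Q` with the fibres of `p`, strictly natural in inert
morphisms. It is encoded by fully faithful functors `app x` into the values of `P`, injective on
objects, whose image consists of the objects of index `x`. -/
structure FibreEmbedding (W : MorphismProperty C) where
  app {a : C} (x : M.obj a) : Q.obj ⟨M.elementsMk a x⟩ ⟶ P.obj ⟨a⟩
  naturality {a b : C} {x : M.obj a} {y : M.obj b} (f : M.elementsMk a x ⟶ M.elementsMk b y) :
    W f.1 → app x ≫ P.map f.1.toLoc = Q.map f.toLoc ≫ app y
  fullyFaithful {a : C} (x : M.obj a) : (app x).toFunctor.FullyFaithful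
  injective {a : C} (x : M.obj a) : Function.Injective (app x).toFunctor.obj
  index_app {a : C} (x : M.obj a) (z : Q.obj ⟨M.elementsMk a x⟩) :
    index p ((app x).toFunctor.obj z) = x
  exists_eq {a : C} (z : P.obj ⟨a⟩) : ∃ z', (app (index p z)).toFunctor.obj z' = z

namespace FibreEmbedding

variable {p Q} (E : FibreEmbedding p Q A.inert)
  (hP : IsPseudoFFunctor A.inert P)
  (hQ : IsPseudoFFunctor (A.inert.inverseImage (CategoryOfElements.π M)) Q)

include E in
theorem exists_eq' {a : C} {x : M.obj a} {z : P.obj ⟨a⟩} (h : index p z = x) :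
    ∃ z', (E.app x).toFunctor.obj z' = z := by
  subst h; exact E.exists_eq z

variable {J : Type uJ} [Bicategory.{wJ, vJ} J] [Strict J]

/-- The embedding of the image under `Q` of a cone in the category of elements into the image under
`P` of its projection. -/
def coneEmbedding {e : M.Elements}
    (S : FCone (A.inert.inverseImage (CategoryOfElements.π M)) J e) :
    ConeEmbedding (S.functor ⋙ Under.post hQ.inertFunctor)
      ((S.image (CategoryOfElements.π M)).functor ⋙ Under.post hP.inertFunctor) where
  vertex := E.app e.2
  leg j := E.app (S.functor.obj j).right.obj.2
  vertex_leg j := E.naturality (S.functor.obj j).hom.hom (S.functor.obj j).hom.property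
  leg_transition f := E.naturality (S.functor.map f).right.hom (S.functor.map f).right.property
  vertexFullyFaithful := E.fullyFaithful _
  legFullyFaithful _ := E.fullyFaithful _
  vertex_injective := E.injective _
  leg_injective _ := E.injective _

include E hQ in
/-- If `P` is a pseudo-model, then so is the pseudofunctor `Q` of its fibres: an object of the
vertex of a marked cone has the required index because its projections do and `M` is a model. -/
theorem isPseudoModel_elements (hM : A.IsSetModel M) (hP : A.IsPseudoModel P) :
    (A.elements M).IsPseudoModel Q where
  isPseudoFFunctor := hQ
  isTwoLimitCone J _ _ e S hS := by
    refine IsCatLimit.isTwoLimitCone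
      ((E.coneEmbedding hP.isPseudoFFunctor hQ S).isCatLimit_of_isCatLimit
        (hP.isTwoLimitCone J e.1 _ hS).isCatLimit fun z hz => E.exists_eq' ?_)
    refine hM.eq_of_forall hS fun j => ?_
    obtain ⟨t, ht⟩ := hz j
    refine (index_map (p := p) _ z).symm.trans ((congrArg (index p) ht).symm.trans ?_)
    exact (E.index_app _ t).trans (S.functor.obj j).hom.hom.2.symm

include E in
/-- If the pseudofunctor `Q` of the fibres of `P` is a pseudo-model, then so is `P`: the image of a
marked cone is covered by the images of its lifts to the category of elements, as a compatible
family of objects has compatible indices, which come from an element over the vertex. -/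
theorem isPseudoModel (hM : A.IsSetModel M) (hP : IsPseudoFFunctor A.inert P)
    (hQ : (A.elements M).IsPseudoModel Q) : A.IsPseudoModel P where
  isPseudoFFunctor := hP
  isTwoLimitCone J _ _ a S hS := by
    refine IsCatLimit.isTwoLimitCone (isCatLimit_of_cover
      (fun x : M.obj a => E.coneEmbedding hP hQ.isPseudoFFunctor (liftCone S x))
      (fun x => (hQ.isTwoLimitCone J _ (liftCone S x) hS).isCatLimit)
      (fun t ht => ?_) (fun z z' h => ?_))
    · obtain ⟨x, hx⟩ := hM.exists_of_compatible hS (fun j => index p (t j)) (fun f =>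
        (index_map (p := p) _ _).symm.trans (congrArg (index p) (ht f)))
      exact ⟨x, fun j => E.exists_eq' (hx j).symm⟩
    · have e : index p z = index p z' := hM.eq_of_forall hS fun j =>
        (index_map (p := p) _ z).symm.trans ((h j).elim (fun k =>
          (index_eq_of_hom k).trans (index_map (p := p) _ z')))
      obtain ⟨y, hy⟩ := E.exists_eq z
      obtain ⟨y', hy'⟩ := E.exists_eq' e.symm
      exact ⟨_, y, y', hy, hy'⟩

end FibreEmbedding

/-- The inclusions of the fibres. -/
def fibreEmbedding {W : MorphismProperty C} [W.IsMultiplicative] (hP : IsPseudoFFunctor W P) :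
    FibreEmbedding p (fibre hP p) W where
  app _ := ⟨ObjectProperty.ι _⟩
  naturality _ _ := rfl
  fullyFaithful _ := ObjectProperty.fullyFaithfulι _
  injective _ _ _ h := ObjectProperty.FullSubcategory.ext h
  index_app _ z := z.property
  exists_eq z := ⟨⟨z, rfl⟩, rfl⟩

theorem isPseudoModel_fibre (hM : A.IsSetModel M) (hP : A.IsPseudoModel P) :
    (A.elements M).IsPseudoModel (fibre hP.isPseudoFFunctor p) :=
  (fibreEmbedding p hP.isPseudoFFunctor).isPseudoModel_elements
    (isPseudoFFunctor_fibre hP.isPseudoFFunctor p) hM hP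

end

end FSketch

/-! ### Strict isomorphisms of pseudofunctors -/

namespace CategoryTheory

/-- A fully faithful functor that is bijective on objects has a strict inverse. -/
theorem Cat.exists_inverse {X Y : Cat.{v₁, u₁}} (F : X ⟶ Y) (hF : F.toFunctor.FullyFaithful)
    (hobj : Function.Bijective F.toFunctor.obj) : ∃ G : Y ⟶ X, F ≫ G = 𝟙 X ∧ G ≫ F = 𝟙 Y := by
  obtain ⟨g, hg, hg'⟩ := Function.bijective_iff_has_inverse.1 hobj
  let m {y y' : Y} (k : y ⟶ y') : g y ⟶ g y' :=
    hF.preimage (eqToHom (hg' y) ≫ k ≫ eqToHom (hg' y').symm)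
  have hm {y y' : Y} (k : y ⟶ y') :
      F.toFunctor.map (m k) = eqToHom (hg' y) ≫ k ≫ eqToHom (hg' y').symm := hF.map_preimage _
  let G : Y ⥤ X :=
    { obj := g
      map := m
      map_id := fun y => hF.map_injective (by
        rw [hm, CategoryTheory.Functor.map_id]
        simp)
      map_comp := fun k k' => hF.map_injective (by
        rw [hm, Functor.map_comp, hm, hm]
        simp) }
  refine ⟨⟨G⟩, Cat.ext (CategoryTheory.Functor.ext hg fun x x' k => hF.map_injective ?_),
    Cat.ext (CategoryTheory.Functor.ext hg' fun y y' k => hm k)⟩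
  rw [Functor.map_comp, Functor.map_comp, eqToHom_map, eqToHom_map]
  exact hm _

namespace Pseudofunctor.StrongTrans

variable {C : Type u} [Category.{v} C] {P Q R : LocallyDiscrete C ⥤ᵖ Cat.{v₁, u₁}}

theorem comp_naturality_app (α : P ⟶ Q) (β : Q ⟶ R) {a b : LocallyDiscrete C} (f : a ⟶ b)
    (z : P.obj a) :
    ((α ≫ β).naturality f).hom.toNatTrans.app z =
      (β.app b).toFunctor.map ((α.naturality f).hom.toNatTrans.app z) ≫
        (β.naturality f).hom.toNatTrans.app ((α.app a).toFunctor.obj z) := by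
  have : ((α ≫ β).naturality f).hom = (α_ _ _ _).inv ≫ (α.naturality f).hom ▷ β.app b ≫
      (α_ _ _ _).hom ≫ α.app a ◁ (β.naturality f).hom ≫ (α_ _ _ _).inv :=
    categoryStruct_comp_naturality_hom α β f
  rw [this]
  simp only [Cat.Hom.toNatTrans_comp, NatTrans.comp_app, Cat.whiskerLeft_app,
    Cat.whiskerRight_app, Cat.associator_hom_app, Cat.associator_inv_app]
  simp

theorem id_naturality_app {a b : LocallyDiscrete C} (f : a ⟶ b) (z : P.obj a) :
    ((𝟙 P : P ⟶ P).naturality f).hom.toNatTrans.app z = 𝟙 _ := by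
  have : ((𝟙 P : P ⟶ P).naturality f).hom = (ρ_ (P.map f)).hom ≫ (λ_ (P.map f)).inv :=
    categoryStruct_id_naturality_hom P f
  rw [this]
  simp only [Cat.Hom.toNatTrans_comp, NatTrans.comp_app, Cat.rightUnitor_hom_app,
    Cat.leftUnitor_inv_app, eqToHom_trans]
  rfl

theorem exists_comp_naturality_app_eq {α : P ⟶ Q} {β : Q ⟶ R} {a b : LocallyDiscrete C}
    {f : a ⟶ b} (hα : ∀ z, ∃ h, (α.naturality f).hom.toNatTrans.app z = eqToHom h)
    (hβ : ∀ z, ∃ h, (β.naturality f).hom.toNatTrans.app z = eqToHom h) (z : P.obj a) :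
    ∃ h, ((α ≫ β).naturality f).hom.toNatTrans.app z = eqToHom h := by
  obtain ⟨h, e⟩ := hα z
  obtain ⟨h', e'⟩ := hβ ((α.app a).toFunctor.obj z)
  rw [comp_naturality_app, e, e', eqToHom_map]
  exact ⟨_, eqToHom_trans _ _⟩

/-- A family of isomorphisms between the values of two strictly unitary pseudofunctors which is
strictly natural and compatible with the compositors is an isomorphism, with strictly natural
inverse. -/
theorem exists_iso_of_strict
    (hP : ∀ a, ∃ h : P.map (𝟙 a) = 𝟙 (P.obj a), P.mapId a = eqToIso h)
    (hQ : ∀ a, ∃ h : Q.map (𝟙 a) = 𝟙 (Q.obj a), Q.mapId a = eqToIso h)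
    (app : ∀ a, P.obj a ⟶ Q.obj a) (inv : ∀ a, Q.obj a ⟶ P.obj a)
    (app_inv : ∀ a, app a ≫ inv a = 𝟙 _) (inv_app : ∀ a, inv a ≫ app a = 𝟙 _)
    (nat : ∀ {a b : LocallyDiscrete C} (f : a ⟶ b), P.map f ≫ app b = app a ≫ Q.map f)
    (comp : ∀ {a b c : LocallyDiscrete C} (f : a ⟶ b) (g : b ⟶ c) (z : P.obj a),
      (app c).toFunctor.map ((P.mapComp f g).hom.toNatTrans.app z) ≍
        (Q.mapComp f g).hom.toNatTrans.app ((app a).toFunctor.obj z)) :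
    ∃ (α : P ⟶ Q) (β : Q ⟶ P), α ≫ β = 𝟙 P ∧ β ≫ α = 𝟙 Q ∧
      (∀ {a b : LocallyDiscrete C} (f : a ⟶ b) (z : P.obj a),
        ∃ h, (α.naturality f).hom.toNatTrans.app z = eqToHom h) ∧
      (∀ {a b : LocallyDiscrete C} (f : a ⟶ b) (z : Q.obj a),
        ∃ h, (β.naturality f).hom.toNatTrans.app z = eqToHom h) := by
  have app_inv_obj {a} (z : P.obj a) : (inv a).toFunctor.obj ((app a).toFunctor.obj z) = z :=
    Functor.congr_obj (congrArg Cat.Hom.toFunctor (app_inv a)) z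
  have inv_app_obj {a} (z : Q.obj a) : (app a).toFunctor.obj ((inv a).toFunctor.obj z) = z :=
    Functor.congr_obj (congrArg Cat.Hom.toFunctor (inv_app a)) z
  have nat' {a b : LocallyDiscrete C} (f : a ⟶ b) : Q.map f ≫ inv b = inv a ≫ P.map f := by
    have := congrArg (fun k => inv a ≫ k ≫ inv b) (nat f)
    simp only [Strict.assoc, app_inv, Strict.comp_id] at this
    rw [this, ← Strict.assoc, inv_app, Strict.id_comp]
  have comp' {a b c : LocallyDiscrete C} (f : a ⟶ b) (g : b ⟶ c) (z : Q.obj a) :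
      (inv c).toFunctor.map ((Q.mapComp f g).hom.toNatTrans.app z) ≍
        (P.mapComp f g).hom.toNatTrans.app ((inv a).toFunctor.obj z) := by
    obtain ⟨z, rfl⟩ : ∃ z', (app a).toFunctor.obj z' = z := ⟨_, inv_app_obj z⟩
    have e₁ := Functor.congr_obj (congrArg Cat.Hom.toFunctor (nat (f ≫ g))) z
    have e₂ := Functor.congr_obj (congrArg Cat.Hom.toFunctor (nat g)) ((P.map f).toFunctor.obj z)
    have e₃ := congrArg (Q.map g).toFunctor.obj
      (Functor.congr_obj (congrArg Cat.Hom.toFunctor (nat f)) z)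
    refine (Functor.map_heq_map (inv c).toFunctor e₁ (e₂.trans e₃) (comp f g z)).symm.trans ?_
    rw [app_inv_obj]
    exact Functor.map_heq_of_eq (congrArg Cat.Hom.toFunctor (app_inv c)) _
  let α : P ⟶ Q := ofComponents hP hQ app (fun f => eqToIso (nat f))
    (fun a z => ⟨_, by rw [eqToIso.hom, Cat.eqToHom_app]⟩)
    (fun {a b c} f g z => by
      simp only [eqToIso.hom, Cat.eqToHom_app, eqToHom_map]
      refine eq_of_heq ((eqToHom_comp_heq _ _).trans ((comp f g z).symm.trans ?_))
      rw [eqToHom_trans]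
      exact (comp_eqToHom_heq _ _).symm)
  let β : Q ⟶ P := ofComponents hQ hP inv (fun f => eqToIso (nat' f))
    (fun a z => ⟨_, by rw [eqToIso.hom, Cat.eqToHom_app]⟩)
    (fun {a b c} f g z => by
      simp only [eqToIso.hom, Cat.eqToHom_app, eqToHom_map]
      refine eq_of_heq ((eqToHom_comp_heq _ _).trans ((comp' f g z).symm.trans ?_))
      rw [eqToHom_trans]
      exact (comp_eqToHom_heq _ _).symm)
  have hα {a b : LocallyDiscrete C} (f : a ⟶ b) (z : P.obj a) :
      ∃ h, (α.naturality f).hom.toNatTrans.app z = eqToHom h := ⟨_, Cat.eqToHom_app _ _ (nat f) z⟩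
  have hβ {a b : LocallyDiscrete C} (f : a ⟶ b) (z : Q.obj a) :
      ∃ h, (β.naturality f).hom.toNatTrans.app z = eqToHom h := ⟨_, Cat.eqToHom_app _ _ (nat' f) z⟩
  exact ⟨α, β,
    ext_of_components (fun a => congrArg Cat.Hom.toFunctor (app_inv a)) fun f z =>
      heq_of_eq_eqToHom (app_inv_obj _) (congrArg (P.map f).toFunctor.obj (app_inv_obj z))
        (exists_comp_naturality_app_eq (hα f) (hβ f) z) ⟨rfl, id_naturality_app f z⟩,
    ext_of_components (fun a => congrArg Cat.Hom.toFunctor (inv_app a)) fun f z =>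
      heq_of_eq_eqToHom (inv_app_obj _) (congrArg (Q.map f).toFunctor.obj (inv_app_obj z))
        (exists_comp_naturality_app_eq (hβ f) (hα f) z) ⟨rfl, id_naturality_app f z⟩,
    hα, hβ⟩

end Pseudofunctor.StrongTrans

end CategoryTheory

/-! ### The total pseudofunctor of a pseudofunctor on a category of elements -/

namespace FSketch

section

variable {C : Type u} [Category.{v} C] {M : C ⥤ Type w}
  (Q : LocallyDiscrete M.Elements ⥤ᵖ Cat.{w, w})

/-- The disjoint union of the values of `Q` at the elements over `a`. -/
abbrev Total (a : C) : Type w := Σ x : M.obj a, Q.obj ⟨M.elementsMk a x⟩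

/-- The inclusion of the summand of index `x`. -/
abbrev inclTotal {a : C} (x : M.obj a) : Q.obj ⟨M.elementsMk a x⟩ ⥤ Total Q a :=
  Sigma.incl (C := fun x : M.obj a => Q.obj ⟨M.elementsMk a x⟩) x

/-- The morphism of elements with source `x` over a morphism `f`. -/
abbrev liftHom {a b : C} (f : a ⟶ b) (x : M.obj a) :
    M.elementsMk a x ⟶ M.elementsMk b (M.map f x) := ⟨f, rfl⟩

/-- The functor between disjoint unions induced by a morphism `f`, which on the summand of index `x`
is the value of `Q` at the morphism of elements over `f`. -/
def totalMap {a b : C} (f : a ⟶ b) : Total Q a ⥤ Total Q b :=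
  Sigma.desc fun x => (Q.map (liftHom f x).toLoc).toFunctor ⋙ inclTotal Q (M.map f x)

variable {a b c d : C} {x : M.obj a} {y : M.obj b} {t : M.obj c} {s : M.obj d}

theorem totalMap_obj (f : M.elementsMk a x ⟶ M.elementsMk b y)
    (z : Q.obj ⟨M.elementsMk a x⟩) :
    (totalMap Q f.1).obj ⟨x, z⟩ = ⟨y, (Q.map f.toLoc).toFunctor.obj z⟩ := by
  obtain ⟨(f : a ⟶ b), (hf : M.map f x = y)⟩ := f
  subst hf
  rfl

theorem totalMap_map (f : M.elementsMk a x ⟶ M.elementsMk b y)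
    {z z' : Q.obj ⟨M.elementsMk a x⟩} (k : z ⟶ z') :
    (totalMap Q f.1).map ((inclTotal Q x).map k) ≍
      (inclTotal Q y).map ((Q.map f.toLoc).toFunctor.map k) := by
  obtain ⟨(f : a ⟶ b), (hf : M.map f x = y)⟩ := f
  subst hf
  rfl

/-- The component at an object of a compositor of the total pseudofunctor. -/
def totalCell (f : a ⟶ b) (g : b ⟶ c) (z : Total Q a) :
    (totalMap Q (f ≫ g)).obj z ≅ (totalMap Q g).obj ((totalMap Q f).obj z) :=
  eqToIso (totalMap_obj Q (liftHom f z.1 ≫ liftHom g _) z.2) ≪≫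
    (inclTotal Q _).mapIso ((Cat.Hom.toNatIso
      (Q.mapComp (liftHom f z.1).toLoc (liftHom g _).toLoc)).app z.2)

/-- A compositor of the total pseudofunctor can be computed from any composable pair of morphisms of
elements over the given one. -/
theorem totalCell_hom (f : M.elementsMk a x ⟶ M.elementsMk b y)
    (g : M.elementsMk b y ⟶ M.elementsMk c t) (z : Q.obj ⟨M.elementsMk a x⟩) :
    (totalCell Q f.1 g.1 ⟨x, z⟩).hom ≍
      (inclTotal Q t).map ((Q.mapComp f.toLoc g.toLoc).hom.toNatTrans.app z) := by
  obtain ⟨(f : a ⟶ b), (hf : M.map f x = y)⟩ := f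
  subst hf
  obtain ⟨(g : b ⟶ c), (hg : M.map g _ = t)⟩ := g
  subst hg
  exact eqToHom_comp_heq ((inclTotal Q _).map ((Q.mapComp (liftHom f x).toLoc
    (liftHom g _).toLoc).hom.toNatTrans.app z)) (totalMap_obj Q (liftHom f x ≫ liftHom g _) z)

theorem totalMap_totalMap_obj (f : M.elementsMk a x ⟶ M.elementsMk b y)
    (g : M.elementsMk b y ⟶ M.elementsMk c t) (z : Q.obj ⟨M.elementsMk a x⟩) :
    (totalMap Q g.1).obj ((totalMap Q f.1).obj ⟨x, z⟩) =
      ⟨t, (Q.map g.toLoc).toFunctor.obj ((Q.map f.toLoc).toFunctor.obj z)⟩ := by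
  rw [totalMap_obj, totalMap_obj]

theorem totalCell_naturality (f : a ⟶ b) (g : b ⟶ c) {z z' : Total Q a} (k : z ⟶ z') :
    (totalMap Q (f ≫ g)).map k ≫ (totalCell Q f g z').hom =
      (totalCell Q f g z).hom ≫ (totalMap Q g).map ((totalMap Q f).map k) := by
  obtain ⟨k⟩ := k
  rename_i x z z'
  have e := congrArg (inclTotal Q _).map ((Q.mapComp (liftHom f x).toLoc
    (liftHom g _).toLoc).hom.toNatTrans.naturality k)
  rw [Functor.map_comp, Functor.map_comp] at e
  have h := totalMap_obj Q (liftHom f x ≫ liftHom g _) z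
  have h' := totalMap_obj Q (liftHom f x ≫ liftHom g _) z'
  exact eq_of_heq ((heq_comp h h' rfl (totalMap_map Q (liftHom f x ≫ liftHom g _) k)
    (totalCell_hom Q (liftHom f x) (liftHom g _) z')).trans ((heq_of_eq e).trans
      (heq_comp h rfl rfl (totalCell_hom Q (liftHom f x) (liftHom g _) z) .rfl).symm))

/-- The compositors of the total pseudofunctor. -/
def totalMapComp (f : a ⟶ b) (g : b ⟶ c) : totalMap Q (f ≫ g) ≅ totalMap Q f ⋙ totalMap Q g :=
  NatIso.ofComponents (totalCell Q f g) (totalCell_naturality Q f g)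

theorem totalCell_assoc (f : a ⟶ b) (g : b ⟶ c) (h : c ⟶ d) (z : Total Q a) :
    (totalCell Q (f ≫ g) h z).hom ≫ (totalMap Q h).map (totalCell Q f g z).hom =
      eqToHom (by rw [Category.assoc]) ≫ (totalCell Q f (g ≫ h) z).hom ≫
        (totalCell Q g h ((totalMap Q f).obj z)).hom := by
  obtain ⟨x, z⟩ := z
  let f' := liftHom f x
  let g' := liftHom g (M.map f x)
  let h' := liftHom h (M.map g (M.map f x))
  have e := congrArg (inclTotal Q _).map (Q.mapComp_assoc_app f'.toLoc g'.toLoc h'.toLoc z)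
  rw [Functor.map_comp, Functor.map_comp, Functor.map_comp, eqToHom_map] at e
  have h₁ := totalMap_obj Q ((f' ≫ g') ≫ h') z
  have h₂ := totalMap_obj Q (f' ≫ g' ≫ h') z
  have h₃ := totalMap_obj Q (g' ≫ h') ((Q.map f'.toLoc).toFunctor.obj z)
  have h₄ := congrArg (totalMap Q h).obj (totalMap_obj Q (f' ≫ g') z)
  refine eq_of_heq ((heq_comp h₁ h₄ rfl (totalCell_hom Q (f' ≫ g') h' z)
    (Functor.map_heq_map _ (totalMap_obj Q (f' ≫ g') z) rfl (totalCell_hom Q f' g' z))).trans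
      ((heq_of_eq e).trans ?_))
  refine (eqToHom_comp_heq _ _).trans (HEq.trans ?_ (eqToHom_comp_heq _ _).symm)
  exact (heq_comp h₂ h₃ rfl (totalCell_hom Q f' (g' ≫ h') z) (totalCell_hom Q g' h' _)).symm

variable {Q} {W : MorphismProperty C} (hQ : IsPseudoFFunctor
  (W.inverseImage (CategoryOfElements.π M)) Q)

section

include hQ

theorem totalCell_eq (f : a ⟶ b) (g : b ⟶ c) (h : W f ∨ W g) (z : Total Q a) :
    ∃ h, (totalCell Q f g z).hom = eqToHom h := by
  obtain ⟨x, z⟩ := z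
  let f' := liftHom f x
  let g' := liftHom g (M.map f x)
  obtain ⟨h', e⟩ := hQ.mapComp_app f' g' h z
  exact exists_eq_eqToHom_of_heq (totalMap_obj Q (f' ≫ g') z) rfl (totalCell_hom Q f' g' z)
    ⟨congrArg (inclTotal Q _).obj h', by rw [e, eqToHom_map]; rfl⟩

theorem totalMap_id (a : C) : totalMap Q (𝟙 a) = 𝟭 (Total Q a) := by
  refine Functor.hext ?_ ?_
  · rintro ⟨x, z⟩
    exact (totalMap_obj Q (𝟙 (M.elementsMk a x)) z).trans
      (congrArg (Sigma.mk x) (hQ.map_id_obj ⟨M.elementsMk a x⟩ z))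
  · rintro ⟨_, _⟩ ⟨_, _⟩ ⟨k⟩
    rename_i x z z'
    refine (totalMap_map Q (𝟙 (M.elementsMk a x)) k).trans ?_
    refine Functor.map_heq_map _ (hQ.map_id_obj ⟨M.elementsMk a x⟩ z)
      (hQ.map_id_obj ⟨M.elementsMk a x⟩ z') ?_
    exact Functor.map_heq_of_eq (congrArg Cat.Hom.toFunctor (hQ.mapId_eq ⟨M.elementsMk a x⟩).1) k

end

variable [W.IsMultiplicative]

/-- The total pseudofunctor of a pseudofunctor `Q` on a category of elements: its value at `a` is
the disjoint union of the values of `Q` at the elements over `a`. -/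
def total : LocallyDiscrete C ⥤ᵖ Cat.{w, w} :=
  Pseudofunctor.ofComponents (fun a => Cat.of (Total Q a)) (fun f => (totalMap Q f).toCatHom)
    (fun a => Cat.ext (totalMap_id hQ a))
    (fun f g => Cat.Hom.isoMk (totalMapComp Q f g))
    (fun f g h z => totalCell_assoc Q f g h z)
    (fun f z => (totalCell_eq hQ (𝟙 _) f (Or.inl (W.id_mem _)) z).2)
    (fun f z => (totalCell_eq hQ f (𝟙 _) (Or.inr (W.id_mem _)) z).2)

theorem isPseudoFFunctor_total : IsPseudoFFunctor W (total hQ) :=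
  .of_components (fun _ => ⟨_, rfl⟩) (fun f g h z => totalCell_eq hQ f g h z)

/-- The functor sending an object of a disjoint union to the index of its summand. -/
def totalIndex (Q : LocallyDiscrete M.Elements ⥤ᵖ Cat.{w, w}) (a : C) :
    Total Q a ⥤ Discrete (M.obj a) :=
  Sigma.desc fun x => (Functor.const _).obj ⟨x⟩

/-- The functors `totalIndex` are natural. -/
def totalIndexNaturality (Q : LocallyDiscrete M.Elements ⥤ᵖ Cat.{w, w}) (f : a ⟶ b) :
    totalMap Q f ⋙ totalIndex Q b ≅
      totalIndex Q a ⋙ (typeToCat.map (M.map f)).toFunctor :=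
  NatIso.ofComponents (fun _ => eqToIso rfl)
    (fun _ => (Discrete.instSubsingletonDiscreteHom (α := M.obj b) _ _).elim _ _)

/-- The projection of the total pseudofunctor to `M`. -/
def totalProj : total hQ ⟶ discretePseudofunctor M :=
  Pseudofunctor.StrongTrans.ofComponents (P := total hQ) (Q := discretePseudofunctor M)
    (isPseudoFFunctor_total hQ).mapId_eq
    (isPseudoFFunctor_discrete W M).mapId_eq
    (fun a => (totalIndex Q a.as).toCatHom)
    (fun f => Cat.Hom.isoMk (totalIndexNaturality Q f.as))
    (fun _ _ => ⟨rfl, rfl⟩)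
    (fun {_ _ c} _ _ _ =>
      (Discrete.instSubsingletonDiscreteHom (α := M.obj c.as) _ _).elim _ _)

theorem isPseudoFTrans_totalProj : IsPseudoFTrans W (totalProj hQ) :=
  isPseudoFTrans_of_components (totalProj hQ) fun _ _ _ => ⟨rfl, rfl⟩

/-- The summands of the total pseudofunctor are its fibres. -/
noncomputable def totalEmbedding : FibreEmbedding (totalProj hQ) Q W where
  app x := ⟨inclTotal Q x⟩
  naturality f _ := Cat.ext (Functor.hext (fun z => totalMap_obj Q f z)
    (fun _ _ k => totalMap_map Q f k))
  fullyFaithful x := .ofFullyFaithful (inclTotal Q x)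
  injective _ _ _ h := eq_of_heq (Sigma.mk.inj h).2
  index_app _ _ := rfl
  exists_eq z := ⟨z.2, rfl⟩

/-- The inclusion of a summand of the total pseudofunctor, as a functor to the fibre. -/
def toFibreTotal (x : M.obj a) : Q.obj ⟨M.elementsMk a x⟩ ⥤ Fibre (totalProj hQ) x :=
  ObjectProperty.lift _ (inclTotal Q x) (fun _ => rfl)

theorem toFibreTotal_bijective (x : M.obj a) :
    Function.Bijective (toFibreTotal hQ x).obj := by
  refine ⟨fun _ _ h => (totalEmbedding hQ).injective x
    (congrArg ObjectProperty.FullSubcategory.obj h), fun z => ?_⟩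
  obtain ⟨⟨_, z⟩, rfl⟩ := z
  exact ⟨z, rfl⟩

/-- `Q` is isomorphic to the pseudofunctor of fibres of its total pseudofunctor. -/
theorem exists_iso_fibre_total :
    ∃ (α : Q ⟶ fibre (isPseudoFFunctor_total hQ) (totalProj hQ))
      (β : fibre (isPseudoFFunctor_total hQ) (totalProj hQ) ⟶ Q),
      α ≫ β = 𝟙 _ ∧ β ≫ α = 𝟙 _ ∧
      IsPseudoFTrans (W.inverseImage (CategoryOfElements.π M)) α ∧
      IsPseudoFTrans (W.inverseImage (CategoryOfElements.π M)) β := by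
  have ff (e : M.Elements) : (toFibreTotal hQ e.2).FullyFaithful :=
    { preimage := fun k => ((totalEmbedding hQ).fullyFaithful e.2).preimage k.hom
      map_preimage := fun k =>
        InducedCategory.Hom.ext (((totalEmbedding hQ).fullyFaithful e.2).map_preimage k.hom)
      preimage_map := ((totalEmbedding hQ).fullyFaithful e.2).preimage_map }
  have ex (e : LocallyDiscrete M.Elements) := Cat.exists_inverse
    (X := Q.obj e) (Y := Cat.of (Fibre (totalProj hQ) e.as.2))
    ⟨toFibreTotal hQ e.as.2⟩ (ff e.as) (toFibreTotal_bijective hQ e.as.2)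
  choose inv app_inv inv_app using ex
  obtain ⟨α, β, h₁, h₂, h₃, h₄⟩ := Pseudofunctor.StrongTrans.exists_iso_of_strict
    (P := Q) (Q := fibre (isPseudoFFunctor_total hQ) (totalProj hQ))
    hQ.mapId_eq (isPseudoFFunctor_fibre (isPseudoFFunctor_total hQ) (totalProj hQ)).mapId_eq
    (fun e => ⟨toFibreTotal hQ e.as.2⟩) inv app_inv inv_app
    (fun f => Cat.ext (Functor.hext
      (fun z => ObjectProperty.FullSubcategory.ext (totalMap_obj Q f.as z).symm)
      (fun z z' k => ObjectProperty.heq_of_hom_heq_hom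
        (ObjectProperty.FullSubcategory.ext (totalMap_obj Q f.as z).symm)
        (ObjectProperty.FullSubcategory.ext (totalMap_obj Q f.as z').symm)
        (totalMap_map Q f.as k).symm)))
    (fun f g z => ObjectProperty.heq_of_hom_heq_hom
      (ObjectProperty.FullSubcategory.ext (totalMap_obj Q (f.as ≫ g.as) z).symm)
      (ObjectProperty.FullSubcategory.ext (totalMap_totalMap_obj Q f.as g.as z).symm)
      (totalCell_hom Q f.as g.as z).symm)
  exact ⟨α, β, h₁, h₂, isPseudoFTrans_of_components α (fun f _ z => h₃ f.toLoc z),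
    isPseudoFTrans_of_components β (fun f _ z => h₄ f.toLoc z)⟩

end

end FSketch

/-! ### The comparison 2-functor -/

namespace FSketch

section

variable {C : Type u} [Category.{v} C] {M : C ⥤ Type w}
  {P Q R : LocallyDiscrete C ⥤ᵖ Cat.{w, w}}
  {p : P ⟶ discretePseudofunctor M} {q : Q ⟶ discretePseudofunctor M}
  {r : R ⟶ discretePseudofunctor M}
  {W : MorphismProperty C} [W.IsMultiplicative]
  {hP : IsPseudoFFunctor W P} {hQ : IsPseudoFFunctor W Q} {hR : IsPseudoFFunctor W R}

theorem fibreTrans_id (h : IsPseudoFTrans W (𝟙 P)) (h' : 𝟙 P ≫ p = p) :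
    fibreTrans (hP := hP) (hQ := hP) h h' = 𝟙 (fibre hP p) :=
  Pseudofunctor.StrongTrans.ext_of_components (fun _ => rfl) fun f z => heq_of_eq <|
    InducedCategory.Hom.ext <|
      (Pseudofunctor.StrongTrans.id_naturality_app (P := P) f.as.1.toLoc z.obj).trans
        (congrArg InducedCategory.Hom.hom
          (Pseudofunctor.StrongTrans.id_naturality_app (P := fibre hP p) f z)).symm

theorem fibreTrans_comp {α : P ⟶ Q} {β : Q ⟶ R} (hα : IsPseudoFTrans W α)
    (hβ : IsPseudoFTrans W β) (hαβ : IsPseudoFTrans W (α ≫ β)) (h : α ≫ q = p) (h' : β ≫ r = q)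
    (h'' : (α ≫ β) ≫ r = p) :
    fibreTrans (hP := hP) (hQ := hR) hαβ h'' =
      fibreTrans (hP := hP) (hQ := hQ) hα h ≫ fibreTrans (hP := hQ) (hQ := hR) hβ h' :=
  Pseudofunctor.StrongTrans.ext_of_components (fun _ => rfl) fun f z => heq_of_eq <|
    InducedCategory.Hom.ext <|
      (Pseudofunctor.StrongTrans.comp_naturality_app α β f.as.1.toLoc z.obj).trans
        (congrArg InducedCategory.Hom.hom
          (Pseudofunctor.StrongTrans.comp_naturality_app
            (fibreTrans (hP := hP) (hQ := hQ) hα h) (fibreTrans (hP := hQ) (hQ := hR) hβ h') f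
              z)).symm

end

variable {C : Type u} [Category.{v} C] {A : FSketch.{uJ, vJ, wJ} C} {M : C ⥤ Type w}
  {hM : A.IsSetModel M}

/-- The pseudo-model of fibres of a pseudo-model over `M`. -/
noncomputable def fibreModel (X : StrictSlice (A.discreteModel M hM)) :
    (A.elements M).PsMod Cat.{w, w} :=
  ⟨fibre X.left.property.isPseudoFFunctor X.hom.hom,
    isPseudoModel_fibre X.hom.hom hM X.left.property⟩

variable {X Y Z : StrictSlice (A.discreteModel M hM)}

/-- The action of `fibreModel` on 1-cells. -/
noncomputable def fibreModelMap (f : X ⟶ Y) : fibreModel X ⟶ fibreModel Y :=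
  ⟨fibreTrans (hP := X.left.property.isPseudoFFunctor) (hQ := Y.left.property.isPseudoFFunctor)
      f.left.property (congrArg LocallyFullSub.Hom.hom f.w),
    isPseudoFTrans_fibreTrans f.left.property (congrArg LocallyFullSub.Hom.hom f.w)⟩

/-- The action of `fibreModel` on 2-cells. -/
noncomputable def fibreModelMap₂ {f g : X ⟶ Y} (η : f ⟶ g) : fibreModelMap f ⟶ fibreModelMap g :=
  ⟨fibreHom (hP := X.left.property.isPseudoFFunctor) (hQ := Y.left.property.isPseudoFFunctor)
    f.left.property g.left.property (congrArg LocallyFullSub.Hom.hom f.w)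
    (congrArg LocallyFullSub.Hom.hom g.w) η.left.hom⟩

/-- 2-cells between pseudo-models in `Cat` that agree up to equality of their boundaries are
compared on components. -/
theorem eq_eqToHom_comp_of_components {C : Type u} [Category.{v} C] {A : FSketch.{uJ, vJ, wJ} C}
    {X Y : A.PsMod Cat.{w, w}} {f g f' g' : X ⟶ Y} {η : f ⟶ g} {θ : f' ⟶ g'} (h : f = f')
    (h' : g' = g) (e : ∀ a (z : X.obj.obj a), (η.hom.as.app a).toNatTrans.app z ≍
      (θ.hom.as.app a).toNatTrans.app z) :
    η = eqToHom h ≫ θ ≫ eqToHom h' := by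
  subst h h'
  simp only [eqToHom_refl, Category.id_comp, Category.comp_id]
  exact LocallyFullSub.hom₂_ext
    (Pseudofunctor.StrongTrans.hom_ext_of_components fun a z => eq_of_heq (e a z))

variable (A hM) in
/-- The 2-functor sending a pseudo-model over `M` to the pseudo-model of its fibres. -/
noncomputable def fibreFunctor :
    StrictPseudofunctor (StrictSlice (A.discreteModel M hM)) ((A.elements M).PsMod Cat.{w, w}) :=
  .mk''
    { obj := fibreModel
      map := fibreModelMap
      map₂ := fibreModelMap₂
      map₂_id := fun _ => LocallyFullSub.hom₂_ext
        (Pseudofunctor.StrongTrans.hom_ext_of_components fun _ _ => rfl)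
      map₂_comp := fun _ _ => LocallyFullSub.hom₂_ext
        (Pseudofunctor.StrongTrans.hom_ext_of_components fun _ _ => rfl)
      map_id := fun X => LocallyFullSub.hom_ext (fibreTrans_id
        (hP := X.left.property.isPseudoFFunctor) (𝟙 X : X ⟶ X).left.property
        (congrArg LocallyFullSub.Hom.hom (𝟙 X : X ⟶ X).w))
      map_comp := fun {X Y Z} f g => LocallyFullSub.hom_ext (fibreTrans_comp
        (hP := X.left.property.isPseudoFFunctor) (hQ := Y.left.property.isPseudoFFunctor)
        (hR := Z.left.property.isPseudoFFunctor) f.left.property g.left.property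
        (f ≫ g).left.property _ _ _)
      map₂_whisker_left := fun _ _ _ _ => eq_eqToHom_comp_of_components _ _ fun _ _ => .rfl
      map₂_whisker_right := fun _ _ => eq_eqToHom_comp_of_components _ _ fun _ _ => .rfl }

end FSketch

open FSketch in
theorem mainTheorem2 {C : Type u} [Category.{v} C] (A : FSketch.{uJ, vJ, wJ} C)
    (M : C ⥤ Type w) (hM : A.IsSetModel M) :
    TwoEquivalent (StrictSlice (A.discreteModel M hM)) ((A.elements M).PsMod Cat.{w, w}) := by
  refine ⟨A.fibreFunctor hM, fun X Y => ⟨⟨fun f g e => ?_, fun β => ?_⟩, fun f g =>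
    ⟨fun η θ e => ?_, fun Γ => ?_⟩⟩, fun Z => ?_⟩
  · exact StrictSlice.hom_ext (LocallyFullSub.hom_ext
      (fibreTrans_injective (hP := X.left.property.isPseudoFFunctor)
        (hQ := Y.left.property.isPseudoFFunctor) f.left.property g.left.property
        (congrArg LocallyFullSub.Hom.hom f.w) (congrArg LocallyFullSub.Hom.hom g.w)
        (congrArg LocallyFullSub.Hom.hom e)))
  · obtain ⟨α, hα, h, e⟩ := exists_fibreTrans_eq (hP := X.left.property.isPseudoFFunctor)
      (hQ := Y.left.property.isPseudoFFunctor) (p := X.hom.hom) (q := Y.hom.hom)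
      (β := β.hom) β.property
    exact ⟨⟨⟨α, hα⟩, LocallyFullSub.hom_ext h⟩, LocallyFullSub.hom_ext e⟩
  · exact StrictSlice.hom₂_ext (LocallyFullSub.hom₂_ext
      ((fibreHom_bijective (hP := X.left.property.isPseudoFFunctor)
        (hQ := Y.left.property.isPseudoFFunctor) f.left.property g.left.property
        (congrArg LocallyFullSub.Hom.hom f.w) (congrArg LocallyFullSub.Hom.hom g.w)).1
        (congrArg LocallyFullSub.Hom₂.hom e)))
  · obtain ⟨Θ, e⟩ := (fibreHom_bijective (hP := X.left.property.isPseudoFFunctor)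
      (hQ := Y.left.property.isPseudoFFunctor) f.left.property g.left.property
      (congrArg LocallyFullSub.Hom.hom f.w) (congrArg LocallyFullSub.Hom.hom g.w)).2 Γ.hom
    -- a modification satisfies the slice condition automatically, as `M` is discrete
    exact ⟨⟨⟨Θ⟩, LocallyFullSub.hom₂_ext
      (Pseudofunctor.StrongTrans.homCategory.ext fun _ => discrete_hom₂_ext _ _)⟩,
      LocallyFullSub.hom₂_ext e⟩
  · have hZ := Z.property.isPseudoFFunctor
    obtain ⟨α, β, h, h', hα, hβ⟩ := exists_iso_fibre_total hZ
    let X : StrictSlice (A.discreteModel M hM) :=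
      ⟨⟨total hZ, (totalEmbedding hZ).isPseudoModel hM (isPseudoFFunctor_total hZ) Z.property⟩,
        ⟨totalProj hZ, isPseudoFTrans_totalProj hZ⟩⟩
    let i : fibreModel X ⟶ Z := ⟨β, hβ⟩
    let j : Z ⟶ fibreModel X := ⟨α, hα⟩
    exact ⟨X, ⟨{ hom := i
                 inv := j
                 hom_inv_id := LocallyFullSub.hom_ext h'
                 inv_hom_id := LocallyFullSub.hom_ext h }⟩⟩
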